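/- Let $0<p<1$ and $\theta\ge 0$. For functions on $\mathbb{R}$ with real or complex values, let $\|f\|_p=\big(\int_{\mathbb R}|f|^p\,dx\big)^{1/p}$ be the quasinorm of $L^p=L^p(\mathbb{R})$. Let $\mathcal{M}=\{M_n\}_{n\ge0}$ be a sequence of positive real numbers such that $n\mapsto\log M_n$ is convex. Assume that $$\kappa(p,\mathcal{M}):=\limsup_{n\to\infty}\sum_{j=1}^n(1-p)^j\log M_j=+\infty$$ and that $\mathcal{M}$ is $p$-regular, i.e. at least one of the following holds: (i) $\liminf_{n\to\infty}(1-p)^n\log M_n>0$; (ii) $\log M_n=o\big((1-p)^{-n}\big)$ as $n\to\infty$, and there is $\delta<1$ such that $n\log n\le(\delta+o(1))\log M_n$ as $n\to\infty$. For $f\in C^\infty(\mathbb{R})$ put $\|f\|_{p,\mathcal{M}}=\sup_{k\ge0}\|f^{(k)}\|_p/M_k$, and let $\mathscr{S}^{\circledast}_{p,\theta,\mathcal{M}}$ be the space of all $f\in C^\infty(\mathbb{R})$ with $\|f\|_{p,\mathcal{M}}<\infty$ and $\limsup_{n\to\infty}(1-p)^n\log\|f^{(n)}\|_\infty\le\theta$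 (where $\log0=-\infty$). Let $W^{p,\theta}_{\mathcal{M}}$ be the completion of $\mathscr{S}^{\circledast}_{p,\theta,\mathcal{M}}$ with respect to the quasinorm $\|\cdot\|_{p,\mathcal{M}}$, and let $\boldsymbol\pi:W^{p,\theta}_{\mathcal{M}}\to L^p\times L^p\times\cdots$ be the canonical map, i.e. the coordinatewise continuous extension of the map $f\mapsto(f,f',f'',\dots)$ on test functions $f\in\mathscr{S}^{\circledast}_{p,\theta,\mathcal{M}}$. Let $\ell^\infty(L^p,\mathcal{M})$ be the space of sequences $(f_n)_{n\ge0}$ in $L^p$ with $\sup_n\|f_n\|_p/M_n<\infty$, and let $c_0(L^p,\mathcal{M})$ be its subspace of sequences with $\lim_{n\to\infty}\|f_n\|_p/M_n=0$. Then $$c_0(L^p,\mathcal{M})\subset\boldsymbol\pi W^{p,\theta}_{\mathcal{M}}\subset\ell^\infty(L^p,\mathcal{M}).$$ In particular, for every sequence $(f_n)_{n\ge0}$ in $L^p$ with $\|f_n\|_p/M_n\to0$ there is an $F\in W^{p,\theta}_{\mathcal{M}}$ with $\boldsymbol\pi F=(f_0,f_1,f_2,\dots)$. -/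

import Mathlib

open MeasureTheory Filter Topology Set
open scoped ENNReal Uniformity

noncomputable section

/-! ### The uniform structure of a quasinorm -/

/-- `d` is a quasi-distance, with the finite constant `C` in the quasi-triangle inequality. -/
structure IsQuasiDist {α : Type*} (d : α → α → ℝ≥0∞) (C : ℝ≥0∞) : Prop where
  const_ne_top : C ≠ ∞
  self : ∀ x, d x x = 0
  symm : ∀ x y, d x y = d y x
  triangle : ∀ x y z, d x z ≤ C * (d x y + d y z)

/-- The uniform structure on `α` whose entourages are generated by the sets `{(x, y) | d x y < ε}`,
`ε > 0`, for a quasi-distance `d`. -/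
@[reducible]
def quasiUniformSpace {α : Type*} {d : α → α → ℝ≥0∞} {C : ℝ≥0∞} (hd : IsQuasiDist d C) :
    UniformSpace α :=
  .ofCore
    { uniformity := ⨅ ε > (0 : ℝ≥0∞), 𝓟 {q : α × α | d q.1 q.2 < ε}
      refl := le_iInf₂ fun ε hε => by
        rw [principal_mono]
        rintro ⟨x, y⟩ (rfl : x = y)
        simpa [hd.self] using hε
      symm := tendsto_iInf_iInf fun ε => tendsto_iInf_iInf fun _ => by
        rw [tendsto_principal_principal]
        rintro ⟨x, y⟩ h
        simpa [hd.symm y x] using h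
      comp := by
        refine le_iInf₂ fun ε hε => ?_
        obtain ⟨δ, hδ, hδε⟩ : ∃ δ > (0 : ℝ≥0∞), C * (δ + δ) < ε := by
          rcases eq_or_ne C 0 with rfl | hC0
          · exact ⟨1, one_pos, by simpa using hε⟩
          · obtain ⟨η, hη, hηε⟩ := exists_between (a₁ := (0 : ℝ≥0∞)) (a₂ := ε) hε
            refine ⟨η / C / 2, ?_, ?_⟩
            · exact ENNReal.half_pos (ENNReal.div_pos hη.ne' hd.const_ne_top).ne'
            · rw [ENNReal.add_halves, ENNReal.mul_div_cancel hC0 hd.const_ne_top]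
              exact hηε
        refine le_trans (lift'_le (mem_iInf_of_mem δ (mem_iInf_of_mem hδ (mem_principal_self _)))
          le_rfl) ?_
        rw [principal_mono]
        rintro ⟨x, z⟩ ⟨y, hxy, hyz⟩
        have hxy' : d x y < δ := hxy
        have hyz' : d y z < δ := hyz
        exact (hd.triangle x y z).trans_lt
          ((mul_le_mul_right (add_le_add hxy'.le hyz'.le) C).trans_lt hδε) }

theorem quasiUniformSpace_hasBasis {α : Type*} {d : α → α → ℝ≥0∞} {C : ℝ≥0∞}
    (hd : IsQuasiDist d C) :
    (𝓤[quasiUniformSpace hd]).HasBasis (fun ε : ℝ≥0∞ => 0 < ε)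
      fun ε => {q : α × α | d q.1 q.2 < ε} := by
  change (⨅ ε > (0 : ℝ≥0∞), 𝓟 {q : α × α | d q.1 q.2 < ε}).HasBasis _ _
  refine hasBasis_biInf_principal (fun a ha b hb => ⟨min a b, ?_, ?_, ?_⟩) ⟨1, ?_⟩
  · exact lt_min (show 0 < a from ha) (show 0 < b from hb)
  · intro q hq
    exact lt_of_lt_of_le (show d q.1 q.2 < min a b from hq) (min_le_left _ _)
  · intro q hq
    exact lt_of_lt_of_le (show d q.1 q.2 < min a b from hq) (min_le_right _ _)
  · exact (one_pos : (0 : ℝ≥0∞) < 1)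

/-! ### The space `L^p(ℝ)` with its quasinorm -/

/-- `L^p(ℝ)`, as a space of classes of functions modulo equality almost everywhere, to be equipped
with the uniform structure of its quasinorm (Mathlib topologizes `Lp` only for `1 ≤ p`). -/
def LpSpace (𝕜 : Type*) [RCLike 𝕜] (p : ℝ) : Type _ :=
  Lp 𝕜 (ENNReal.ofReal p) (volume : Measure ℝ)

instance (𝕜 : Type*) [RCLike 𝕜] (p : ℝ) : AddCommGroup (LpSpace 𝕜 p) :=
  inferInstanceAs (AddCommGroup (Lp 𝕜 (ENNReal.ofReal p) (volume : Measure ℝ)))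

/-- The underlying (class of) function(s) of an element of `L^p(ℝ)`. -/
def LpSpace.toLp {𝕜 : Type*} [RCLike 𝕜] {p : ℝ} (f : LpSpace 𝕜 p) :
    Lp 𝕜 (ENNReal.ofReal p) (volume : Measure ℝ) := f

/-- The element of `L^p(ℝ)` given by a `p`-integrable function. -/
def LpSpace.ofMemLp {𝕜 : Type*} [RCLike 𝕜] {p : ℝ} (f : ℝ → 𝕜)
    (hf : MemLp f (ENNReal.ofReal p) (volume : Measure ℝ)) : LpSpace 𝕜 p :=
  hf.toLp f

theorem LpSpace.coeFn_ofMemLp {𝕜 : Type*} [RCLike 𝕜] {p : ℝ} {f : ℝ → 𝕜}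
    (hf : MemLp f (ENNReal.ofReal p) (volume : Measure ℝ)) :
    ⇑(LpSpace.ofMemLp f hf).toLp =ᵐ[volume] f :=
  hf.coeFn_toLp

/-- The quasinorm `‖f‖_p` of `L^p(ℝ)`. -/
def LpSpace.qnorm {𝕜 : Type*} [RCLike 𝕜] {p : ℝ} (f : LpSpace 𝕜 p) : ℝ≥0∞ :=
  eLpNorm f.toLp (ENNReal.ofReal p) volume

theorem LpSpace.qnorm_sub {𝕜 : Type*} [RCLike 𝕜] {p : ℝ} (f g : LpSpace 𝕜 p) :
    (f - g).qnorm = eLpNorm (⇑f.toLp - ⇑g.toLp) (ENNReal.ofReal p) volume :=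
  eLpNorm_congr_ae (Lp.coeFn_sub f.toLp g.toLp)

theorem LpSpace.isQuasiDist (𝕜 : Type*) [RCLike 𝕜] (p : ℝ) :
    IsQuasiDist (fun f g : LpSpace 𝕜 p => (f - g).qnorm)
      (ENNReal.LpAddConst (ENNReal.ofReal p)) where
  const_ne_top := (ENNReal.LpAddConst_lt_top _).ne
  self f := by rw [LpSpace.qnorm_sub, sub_self, eLpNorm_zero]
  symm f g := by simp only [LpSpace.qnorm_sub]; exact eLpNorm_sub_comm _ _ _ _
  triangle f g h := by
    simp only [LpSpace.qnorm_sub]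
    have := eLpNorm_add_le' ((Lp.aestronglyMeasurable f.toLp).sub (Lp.aestronglyMeasurable g.toLp))
      ((Lp.aestronglyMeasurable g.toLp).sub (Lp.aestronglyMeasurable h.toLp)) (ENNReal.ofReal p)
    rwa [sub_add_sub_cancel] at this

/-- `L^p(ℝ)` carries the uniform structure of its quasinorm. -/
instance (𝕜 : Type*) [RCLike 𝕜] (p : ℝ) : UniformSpace (LpSpace 𝕜 p) :=
  quasiUniformSpace (LpSpace.isQuasiDist 𝕜 p)

/-! ### Weight sequences -/

/-- The `p`-characteristic `κ(p, M) = limsup_n ∑_{j=1}^n (1-p)^j log M_j`. -/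
def pCharacteristic (p : ℝ) (M : ℕ → ℝ) : EReal :=
  limsup (fun n : ℕ => ((∑ j ∈ Finset.Icc 1 n, (1 - p) ^ j * Real.log (M j) : ℝ) : EReal)) atTop

/-- `p`-regular weight sequences (with infinite `p`-characteristic). -/
structure IsPRegular (p : ℝ) (M : ℕ → ℝ) : Prop where
  pos : ∀ n, 0 < M n
  logConvex : ∀ n, 2 * Real.log (M (n + 1)) ≤ Real.log (M n) + Real.log (M (n + 2))
  char_eq_top : pCharacteristic p M = ⊤
  regular :
    0 < liminf (fun n : ℕ => (((1 - p) ^ n * Real.log (M n) : ℝ) : EReal)) atTop ∨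
    ((fun n : ℕ => Real.log (M n)) =o[atTop] (fun n : ℕ => ((1 - p) ^ n)⁻¹) ∧
      ∃ δ : ℝ, δ < 1 ∧ ∃ e : ℕ → ℝ, Tendsto e atTop (𝓝 0) ∧
        ∀ᶠ n : ℕ in atTop, (n : ℝ) * Real.log n ≤ (δ + e n) * Real.log (M n))

/-! ### The quasinorm `‖·‖_{p,M}`, the test functions, and the Carleman space -/

/-- The quasinorm `‖f‖_{p,M} = sup_k ‖f^{(k)}‖_p / M_k`. -/
def carlemanQNorm {𝕜 : Type*} [RCLike 𝕜] (p : ℝ) (M : ℕ → ℝ) (f : ℝ → 𝕜) : ℝ≥0∞ :=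
  ⨆ k : ℕ, eLpNorm (iteratedDeriv k f) (ENNReal.ofReal p) volume / ENNReal.ofReal (M k)

/-- The test function class: the `f ∈ C^∞(ℝ)` with `‖f‖_{p,M} < ∞` and
`limsup_n (1-p)^n log ‖f^{(n)}‖_∞ ≤ θ`, where `log 0 = -∞` and `log ∞ = ∞`. -/
def CarlemanTest (𝕜 : Type*) [RCLike 𝕜] (p θ : ℝ) (M : ℕ → ℝ) : Type _ :=
  {f : ℝ → 𝕜 // ContDiff ℝ (⊤ : ℕ∞) f ∧ carlemanQNorm p M f < ∞ ∧
    limsup (fun n : ℕ => (((1 - p) ^ n : ℝ) : EReal) *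
      ENNReal.log (eLpNorm (iteratedDeriv n f) ∞ volume)) atTop ≤ (θ : EReal)}

theorem CarlemanTest.iteratedDeriv_sub {𝕜 : Type*} [RCLike 𝕜] {p θ : ℝ} {M : ℕ → ℝ}
    (f g : CarlemanTest 𝕜 p θ M) (k : ℕ) :
    iteratedDeriv k (f.1 - g.1) = iteratedDeriv k f.1 - iteratedDeriv k g.1 := by
  ext x
  exact _root_.iteratedDeriv_sub (f.2.1.contDiffAt.of_le (mod_cast le_top))
    (g.2.1.contDiffAt.of_le (mod_cast le_top))

theorem CarlemanTest.aestronglyMeasurable {𝕜 : Type*} [RCLike 𝕜] {p θ : ℝ} {M : ℕ → ℝ}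
    (f : CarlemanTest 𝕜 p θ M) (k : ℕ) :
    AEStronglyMeasurable (iteratedDeriv k f.1) (volume : Measure ℝ) :=
  (f.2.1.continuous_iteratedDeriv k (mod_cast le_top)).aestronglyMeasurable

theorem CarlemanTest.isQuasiDist (𝕜 : Type*) [RCLike 𝕜] (p θ : ℝ) (M : ℕ → ℝ) :
    IsQuasiDist (fun f g : CarlemanTest 𝕜 p θ M => carlemanQNorm p M (f.1 - g.1))
      (ENNReal.LpAddConst (ENNReal.ofReal p)) where
  const_ne_top := (ENNReal.LpAddConst_lt_top _).ne
  self f := by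
    unfold carlemanQNorm
    simp_rw [CarlemanTest.iteratedDeriv_sub, sub_self, eLpNorm_zero, ENNReal.zero_div, iSup_const]
  symm f g := by
    simp only [carlemanQNorm, CarlemanTest.iteratedDeriv_sub]
    exact iSup_congr fun k => by rw [eLpNorm_sub_comm]
  triangle f g h := by
    simp only [carlemanQNorm, CarlemanTest.iteratedDeriv_sub]
    refine iSup_le fun k => ?_
    have h1 := eLpNorm_add_le' ((f.aestronglyMeasurable k).sub (g.aestronglyMeasurable k))
      ((g.aestronglyMeasurable k).sub (h.aestronglyMeasurable k)) (ENNReal.ofReal p)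
    rw [sub_add_sub_cancel] at h1
    refine (ENNReal.div_le_div_right h1 _).trans ?_
    rw [mul_div_assoc, ENNReal.add_div]
    refine mul_le_mul_right (add_le_add ?_ ?_) _
    · exact le_iSup (fun k => eLpNorm (iteratedDeriv k f.1 - iteratedDeriv k g.1)
        (ENNReal.ofReal p) volume / ENNReal.ofReal (M k)) k
    · exact le_iSup (fun k => eLpNorm (iteratedDeriv k g.1 - iteratedDeriv k h.1)
        (ENNReal.ofReal p) volume / ENNReal.ofReal (M k)) k

/-- The test functions carry the uniform structure of the quasinorm `‖·‖_{p,M}`. -/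
instance (𝕜 : Type*) [RCLike 𝕜] (p θ : ℝ) (M : ℕ → ℝ) : UniformSpace (CarlemanTest 𝕜 p θ M) :=
  quasiUniformSpace (CarlemanTest.isQuasiDist 𝕜 p θ M)

/-- The `L^p`-Carleman space `W^{p,θ}_M`: the abstract completion of the test function class with
respect to the quasinorm `‖·‖_{p,M}`. -/
abbrev CarlemanSpace (𝕜 : Type*) [RCLike 𝕜] (p θ : ℝ) (M : ℕ → ℝ) : Type _ :=
  UniformSpace.Completion (CarlemanTest 𝕜 p θ M)

/-! ### The canonical map `π` -/

theorem CarlemanTest.memLp {𝕜 : Type*} [RCLike 𝕜] {p θ : ℝ} {M : ℕ → ℝ}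
    (f : CarlemanTest 𝕜 p θ M) (k : ℕ) :
    MemLp (iteratedDeriv k f.1) (ENNReal.ofReal p) (volume : Measure ℝ) := by
  refine ⟨f.aestronglyMeasurable k, lt_top_iff_ne_top.2 fun htop => ?_⟩
  have h := (le_iSup (fun k => eLpNorm (iteratedDeriv k f.1)
    (ENNReal.ofReal p) volume / ENNReal.ofReal (M k)) k).trans_lt f.2.2.1
  simp [htop, ENNReal.top_div_of_ne_top] at h

/-- The `n`-th derivative of a test function, as an element of `L^p(ℝ)`. -/
def CarlemanTest.derivLp {𝕜 : Type*} [RCLike 𝕜] {p θ : ℝ} {M : ℕ → ℝ} (n : ℕ)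
    (f : CarlemanTest 𝕜 p θ M) : LpSpace 𝕜 p :=
  LpSpace.ofMemLp (iteratedDeriv n f.1) (f.memLp n)

/-- The canonical map `π : W^{p,θ}_M → L^p × L^p × ⋯`, the coordinatewise continuous extension to
the completion of `f ↦ (f, f', f'', …)` on test functions. -/
def carlemanPi {𝕜 : Type*} [RCLike 𝕜] {p θ : ℝ} {M : ℕ → ℝ} (F : CarlemanSpace 𝕜 p θ M) :
    ℕ → LpSpace 𝕜 p :=
  fun n => UniformSpace.Completion.extension (CarlemanTest.derivLp n) F

/-! ### The sequence spaces -/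

/-- `ℓ^∞(L^p, M)`: the sequences in `L^p` with `sup_n ‖f_n‖_p / M_n < ∞`. -/
def ellInftyLp (𝕜 : Type*) [RCLike 𝕜] (p : ℝ) (M : ℕ → ℝ) : Set (ℕ → LpSpace 𝕜 p) :=
  {f | ⨆ n, (f n).qnorm / ENNReal.ofReal (M n) < ∞}

/-- `c_0(L^p, M)`: the sequences in `ℓ^∞(L^p, M)` with `‖f_n‖_p / M_n → 0`. -/
def cZeroLp (𝕜 : Type*) [RCLike 𝕜] (p : ℝ) (M : ℕ → ℝ) : Set (ℕ → LpSpace 𝕜 p) :=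
  {f | f ∈ ellInftyLp 𝕜 p M ∧
    Tendsto (fun n => (f n).qnorm / ENNReal.ofReal (M n)) atTop (𝓝 0)}

/-! ### The canonical map is well defined -/

theorem LpSpace.hasBasis_uniformity (𝕜 : Type*) [RCLike 𝕜] (p : ℝ) :
    (𝓤 (LpSpace 𝕜 p)).HasBasis (fun ε : ℝ≥0∞ => 0 < ε) fun ε => {q | (q.1 - q.2).qnorm < ε} :=
  quasiUniformSpace_hasBasis (LpSpace.isQuasiDist 𝕜 p)

theorem CarlemanTest.hasBasis_uniformity (𝕜 : Type*) [RCLike 𝕜] (p θ : ℝ) (M : ℕ → ℝ) :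
    (𝓤 (CarlemanTest 𝕜 p θ M)).HasBasis (fun ε : ℝ≥0∞ => 0 < ε)
      fun ε => {q | carlemanQNorm p M (q.1.1 - q.2.1) < ε} :=
  quasiUniformSpace_hasBasis (CarlemanTest.isQuasiDist 𝕜 p θ M)

theorem CarlemanTest.uniformContinuous_derivLp {𝕜 : Type*} [RCLike 𝕜] {p θ : ℝ} {M : ℕ → ℝ}
    (n : ℕ) : UniformContinuous (CarlemanTest.derivLp n : CarlemanTest 𝕜 p θ M → LpSpace 𝕜 p) := by
  rw [(CarlemanTest.hasBasis_uniformity 𝕜 p θ M).uniformContinuous_iff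
    (LpSpace.hasBasis_uniformity 𝕜 p)]
  intro ε hε
  refine ⟨ε / (ENNReal.ofReal (M n) + 1), ENNReal.div_pos hε.ne' (by simp), fun f g h => ?_⟩
  have h' : carlemanQNorm p M (f.1 - g.1) < ε / (ENNReal.ofReal (M n) + 1) := h
  have h1 : eLpNorm (iteratedDeriv n f.1 - iteratedDeriv n g.1) (ENNReal.ofReal p) volume /
      ENNReal.ofReal (M n) < ε / (ENNReal.ofReal (M n) + 1) := by
    refine lt_of_le_of_lt ?_ h'
    rw [← CarlemanTest.iteratedDeriv_sub]
    exact le_iSup (fun k => eLpNorm (iteratedDeriv k (f.1 - g.1)) (ENNReal.ofReal p) volume /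
      ENNReal.ofReal (M k)) n
  have h2 : (CarlemanTest.derivLp n f - CarlemanTest.derivLp n g).qnorm =
      eLpNorm (iteratedDeriv n f.1 - iteratedDeriv n g.1) (ENNReal.ofReal p) volume := by
    rw [LpSpace.qnorm_sub]
    exact eLpNorm_congr_ae
      ((LpSpace.coeFn_ofMemLp (f.memLp n)).sub (LpSpace.coeFn_ofMemLp (g.memLp n)))
  change (CarlemanTest.derivLp n f - CarlemanTest.derivLp n g).qnorm < ε
  rw [h2]
  generalize eLpNorm (iteratedDeriv n f.1 - iteratedDeriv n g.1) (ENNReal.ofReal p) volume = x at h1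
  rcases eq_or_ne (ENNReal.ofReal (M n)) 0 with hM | hM
  · rcases eq_or_ne x 0 with rfl | hx
    · exact hε
    · simp [hM, ENNReal.div_zero hx] at h1
  · rw [ENNReal.div_lt_iff (Or.inl hM) (Or.inl ENNReal.ofReal_ne_top)] at h1
    refine h1.trans_le ?_
    calc ε / (ENNReal.ofReal (M n) + 1) * ENNReal.ofReal (M n)
        ≤ ε / (ENNReal.ofReal (M n) + 1) * (ENNReal.ofReal (M n) + 1) := by gcongr; simp
      _ = ε := ENNReal.div_mul_cancel (by simp) (by simp)

theorem LpSpace.t0Space {𝕜 : Type*} [RCLike 𝕜] {p : ℝ} (hp : 0 < p) : T0Space (LpSpace 𝕜 p) := by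
  rw [t0Space_iff_uniformity]
  intro f g hfg
  have h0 : (f - g).qnorm = 0 := by
    by_contra h
    have h1 : (f - g).qnorm < (f - g).qnorm :=
      hfg _ ((LpSpace.hasBasis_uniformity 𝕜 p).mem_of_mem (pos_iff_ne_zero.2 h))
    exact lt_irrefl _ h1
  rw [LpSpace.qnorm_sub, eLpNorm_eq_zero_iff ((Lp.aestronglyMeasurable f.toLp).sub
    (Lp.aestronglyMeasurable g.toLp)) (by simpa using hp)] at h0
  have h1 : f.toLp = g.toLp := Lp.ext (h0.mono fun x hx => sub_eq_zero.1 hx)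
  exact h1

/-- `L^p(ℝ)` is complete for `0 < p ≤ 1`. -/
theorem LpSpace.completeSpace {𝕜 : Type*} [RCLike 𝕜] {p : ℝ} (hp : 0 < p) (hp1 : p ≤ 1) :
    CompleteSpace (LpSpace 𝕜 p) := by
  have hp0 : ENNReal.ofReal p ≠ 0 := by simpa using hp
  have hB0 : ∀ n : ℕ, (0 : ℝ≥0∞) < (2⁻¹ : ℝ≥0∞) ^ n := fun n =>
    ENNReal.pow_pos (by simp) n
  have : (𝓤 (LpSpace 𝕜 p)).IsCountablyGenerated := by
    refine (HasBasis.mk (p := fun _ : ℕ => True)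
      (s := fun n => {q : LpSpace 𝕜 p × LpSpace 𝕜 p | (q.1 - q.2).qnorm < 2⁻¹ ^ n})
      fun t => ?_).isCountablyGenerated
    rw [(LpSpace.hasBasis_uniformity 𝕜 p).mem_iff]
    constructor
    · rintro ⟨ε, hε, h⟩
      obtain ⟨n, hn⟩ := ENNReal.exists_inv_two_pow_lt hε.ne'
      exact ⟨n, trivial, fun q hq => h (lt_trans hq hn)⟩
    · rintro ⟨n, -, h⟩
      exact ⟨_, hB0 n, h⟩
  -- a rapidly Cauchy sequence converges almost everywhere, and then in quasinorm by Fatou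
  refine UniformSpace.complete_of_convergent_controlled_sequences
    (fun n => {q : LpSpace 𝕜 p × LpSpace 𝕜 p | (q.1 - q.2).qnorm < 2⁻¹ ^ n})
    (fun n => (LpSpace.hasBasis_uniformity 𝕜 p).mem_of_mem (hB0 n)) fun u hu => ?_
  set v : ℕ → ℝ → 𝕜 := fun n => ⇑(u n).toLp with hv
  have hvm : ∀ n, AEStronglyMeasurable (v n) volume := fun n => Lp.aestronglyMeasurable (u n).toLp
  have hcau : ∀ N n m : ℕ, N ≤ n → N ≤ m →
      eLpNorm (v n - v m) (ENNReal.ofReal p) volume < 2⁻¹ ^ N := by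
    intro N n m hn hm
    have h : (u n - u m).qnorm < 2⁻¹ ^ N := hu N n m hn hm
    rwa [LpSpace.qnorm_sub] at h
  have hBsum : ∑' n : ℕ, (2⁻¹ : ℝ≥0∞) ^ n ≠ ∞ := by
    rw [ENNReal.tsum_geometric]
    simp
  have hstep : ∀ n, ∫⁻ x, ‖v (n + 1) x - v n x‖ₑ ^ p ≤ ((2⁻¹ : ℝ≥0∞) ^ p) ^ n := by
    intro n
    have h := (hcau n (n + 1) n n.le_succ le_rfl).le
    rw [eLpNorm_eq_lintegral_rpow_enorm_toReal hp0 ENNReal.ofReal_ne_top,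
      ENNReal.toReal_ofReal hp.le] at h
    have h2 := ENNReal.rpow_le_rpow h hp.le
    rw [← ENNReal.rpow_mul, one_div, inv_mul_cancel₀ hp.ne', ENNReal.rpow_one] at h2
    refine h2.trans (le_of_eq ?_)
    rw [← ENNReal.rpow_natCast, ← ENNReal.rpow_natCast, ← ENNReal.rpow_mul, ← ENNReal.rpow_mul,
      mul_comm]
  have hmeas : ∀ n, AEMeasurable (fun x => ‖v (n + 1) x - v n x‖ₑ ^ p) volume :=
    fun n => ((hvm (n + 1)).sub (hvm n)).enorm.pow_const p
  have hint : ∫⁻ x, ∑' n, ‖v (n + 1) x - v n x‖ₑ ^ p ≠ ∞ := by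
    rw [lintegral_tsum hmeas]
    refine ne_top_of_le_ne_top ?_ (ENNReal.tsum_le_tsum hstep)
    rw [ENNReal.tsum_geometric]
    refine ENNReal.inv_ne_top.2 (tsub_pos_of_lt ?_).ne'
    exact ENNReal.rpow_lt_one (by simp) hp
  have hae : ∀ᵐ x ∂(volume : Measure ℝ), ∃ l : 𝕜, Tendsto (fun n => v n x) atTop (𝓝 l) := by
    have h1 := ae_lt_top' (AEMeasurable.tsum hmeas) hint
    filter_upwards [h1] with x hx
    have hsum : Summable fun n => ‖v (n + 1) x - v n x‖ ^ p := by
      have h3 := ENNReal.summable_toReal hx.ne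
      refine h3.congr fun n => ?_
      rw [← ENNReal.toReal_rpow, toReal_enorm]
    have hsum' : Summable fun n => ‖v (n + 1) x - v n x‖ := by
      refine hsum.of_norm_bounded_eventually_nat ?_
      filter_upwards [hsum.tendsto_atTop_zero.eventually (gt_mem_nhds one_pos)] with n hn
      rw [norm_norm]
      have h4 : ‖v (n + 1) x - v n x‖ ≤ 1 := by
        by_contra! h5
        exact absurd hn (not_lt.2 (Real.one_le_rpow h5.le hp.le))
      calc ‖v (n + 1) x - v n x‖ = ‖v (n + 1) x - v n x‖ ^ (1 : ℝ) := (Real.rpow_one _).symm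
        _ ≤ _ := Real.rpow_le_rpow_of_exponent_ge_of_imp (norm_nonneg _) h4 hp1
          (by intro _ h6; exact absurd h6 one_ne_zero)
    refine cauchySeq_tendsto_of_complete (cauchySeq_of_summable_dist ?_)
    refine hsum'.congr fun n => ?_
    rw [dist_comm, dist_eq_norm]
  obtain ⟨w, hwm, hw⟩ := exists_stronglyMeasurable_limit_of_tendsto_ae hvm hae
  have hlim := Lp.cauchy_tendsto_of_tendsto (p := ENNReal.ofReal p) hvm w hBsum hcau hw
  have hwp : MemLp w (ENNReal.ofReal p) volume := by
    obtain ⟨n, hn⟩ := (hlim.eventually (gt_mem_nhds one_pos)).exists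
    have h1 : MemLp (v n - w) (ENNReal.ofReal p) volume :=
      ⟨(hvm n).sub hwm.aestronglyMeasurable, hn.trans ENNReal.one_lt_top⟩
    have h2 := (Lp.memLp (u n).toLp).sub h1
    simpa [hv] using h2
  refine ⟨LpSpace.ofMemLp w hwp, ?_⟩
  rw [(nhds_basis_uniformity (LpSpace.hasBasis_uniformity 𝕜 p)).tendsto_right_iff]
  intro ε hε
  filter_upwards [hlim.eventually (gt_mem_nhds hε)] with n hn
  rw [LpSpace.qnorm_sub]
  refine lt_of_eq_of_lt (eLpNorm_congr_ae ?_) hn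
  exact (EventuallyEq.refl _ _).sub (LpSpace.coeFn_ofMemLp hwp)

/-- On test functions, `π f = (f, f', f'', …)`. -/
theorem carlemanPi_coe {𝕜 : Type*} [RCLike 𝕜] {p θ : ℝ} {M : ℕ → ℝ} (hp : 0 < p)
    (f : CarlemanTest 𝕜 p θ M) (n : ℕ) :
    carlemanPi (f : CarlemanSpace 𝕜 p θ M) n = CarlemanTest.derivLp n f :=
  have := LpSpace.t0Space (𝕜 := 𝕜) hp
  UniformSpace.Completion.extension_coe (CarlemanTest.uniformContinuous_derivLp n) f

/-- The coordinates of `π` are continuous. -/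
theorem continuous_carlemanPi {𝕜 : Type*} [RCLike 𝕜] {p θ : ℝ} {M : ℕ → ℝ} (hp : 0 < p)
    (hp1 : p ≤ 1) (n : ℕ) : Continuous fun F : CarlemanSpace 𝕜 p θ M => carlemanPi F n :=
  have := LpSpace.completeSpace (𝕜 := 𝕜) hp hp1
  UniformSpace.Completion.continuous_extension

end

/-! The inclusion in `ellInftyLp` is soft: a point of the completion lies within bounded distance of
a test function, and coordinates are continuous. The content of the other inclusion is that
derivatives decouple in `L^p` for `p < 1`: if `‖f_k‖_p / M_k → 0` and `ε > 0`, one test function `g`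
satisfies `‖g^(k) - f_k‖_p ≤ ε M_k` for all `k` at once (`IsPRegular.exists_test`). Such functions
with `ε = 1/(j+1)` form a Cauchy sequence, and its limit is mapped to `(f_k)`.

The tail of `(f_k)` is small by itself, so finitely many entries matter, and they can be treated one
at a time because `∫ |f|^p` is subadditive. By density, a single entry `f_n` is a step function, so
it suffices to find `v` with `v^(n)` close to the indicator of `[0, h)` and all other derivatives
small (`IsPRegular.exists_bump`). Take `v = x^n/n! (H(x) - H(x-h))` with `H` a smooth Heaviside
step. Leibniz terms that differentiate `H` are small if `∫ |H^(k)|^p ≤ δ M_k^p` for `k ≥ 1`, since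
`binom(k,i) M_(k-i) ≤ c^i M_k`. The remaining term is the plateau for `k = n`, zero for `k > n`, and
for `k < n` at most `2h` on an interval of length `2h`; over the `O(1/h)` translates in a step
function this adds up to `O(h^p)`.

The heart is `H` (`exists_box_lengths`). Average the Heaviside function over intervals of lengths
`a_0, a_1, …`. Then `H^(k+1)` is a signed sum of `2^k` translates of a function of height at most
`∏_{j≤k} 1/a_j` on an interval of length `∑_{j≥k} a_j`. With `a_j = exp(-b_j)` and a tail comparable
to `a_k`, smallness requires `p ∑_{j<k} b_j - (1-p) b_k` to stay well below `p log M_(k+1)`. If `b_j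
= p D_j + (1-p) b_(j+1)`, with `D` the increments of `log M`, this telescopes to `p ∑_{j<k} D_j -
(1-p) b_0` with `b_0 = p ∑ (1-p)^g D_g`. By Abel summation and `κ = ∞`, truncating `D` far out makes
`b_0` as large as desired while `b` stays bounded. Regularity yields `log M_n ≥ ρ n log(n+1) - C`
with `ρ > 1`; a fraction `η` of `log M` feeds the recursion, and the rest pays for the factor `2^k`
and for an extra `ρ₁ log(j+1)` in `b_j`, `ρ₁ > 1`, which makes `∑ a_j` converge. As `b_j` grows only
logarithmically, `‖H^(k)‖_∞ ≤ exp(A(k+1)^2)`, so the growth condition on test functions holds for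
every `θ ≥ 0`. -/

noncomputable section

/-! ### Infinite convolutions of box functions -/

/-- The average of `u` over the interval `[x - a, x]`. -/
def boxAverage (a : ℝ) (u : ℝ → ℝ) (x : ℝ) : ℝ := ∫ t in (0 : ℝ)..1, u (x - a * t)

theorem boxAverage_eq {a : ℝ} (ha : 0 < a) (u : ℝ → ℝ) (x : ℝ) :
    boxAverage a u x = a⁻¹ * ∫ t in (x - a)..x, u t := by
  unfold boxAverage
  rw [intervalIntegral.integral_comp_sub_mul u ha.ne' x]
  simp

/-- Monotone functions with values in `[0, 1]`. -/
structure IsUnitMonotone (u : ℝ → ℝ) : Prop where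
  mono : Monotone u
  nonneg : ∀ x, 0 ≤ u x
  le_one : ∀ x, u x ≤ 1

theorem IsUnitMonotone.intervalIntegrable {u : ℝ → ℝ} (hu : IsUnitMonotone u) (a b : ℝ) :
    IntervalIntegrable u volume a b :=
  hu.mono.intervalIntegrable

theorem IsUnitMonotone.comp_sub_mul_intervalIntegrable {u : ℝ → ℝ} (hu : IsUnitMonotone u)
    {a : ℝ} (ha : 0 ≤ a) (x b c : ℝ) :
    IntervalIntegrable (fun t => u (x - a * t)) volume b c := by
  apply Antitone.intervalIntegrable
  intro s t hst
  apply hu.mono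
  gcongr

theorem IsUnitMonotone.boxAverage {u : ℝ → ℝ} (hu : IsUnitMonotone u) {a : ℝ} (ha : 0 ≤ a) :
    IsUnitMonotone (boxAverage a u) where
  mono x y hxy := by
    refine intervalIntegral.integral_mono_on zero_le_one
      (hu.comp_sub_mul_intervalIntegrable ha _ _ _) (hu.comp_sub_mul_intervalIntegrable ha _ _ _)
      fun t _ => hu.mono (by linarith)
  nonneg x := intervalIntegral.integral_nonneg zero_le_one fun t _ => hu.nonneg _
  le_one x := by
    have := intervalIntegral.integral_mono_on zero_le_one
      (hu.comp_sub_mul_intervalIntegrable ha x 0 1)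
      (intervalIntegrable_const (c := (1 : ℝ))) fun t _ => hu.le_one _
    simpa [_root_.boxAverage] using this

theorem boxAverage_le_boxAverage {u v : ℝ → ℝ} (hu : IsUnitMonotone u) (hv : IsUnitMonotone v)
    {a : ℝ} (ha : 0 ≤ a) (h : ∀ x, u x ≤ v x) (x : ℝ) : boxAverage a u x ≤ boxAverage a v x :=
  intervalIntegral.integral_mono_on zero_le_one
    (hu.comp_sub_mul_intervalIntegrable ha _ _ _) (hv.comp_sub_mul_intervalIntegrable ha _ _ _)
    fun _ _ => h _

/-- The Heaviside function averaged successively over intervals of lengths `a 0, …, a (n - 1)`. -/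
def stepApprox : (ℕ → ℝ) → ℕ → ℝ → ℝ
  | _, 0 => (Ici 0).indicator 1
  | a, n + 1 => boxAverage (a 0) (stepApprox (fun j => a (j + 1)) n)

theorem stepApprox_isUnitMonotone {a : ℕ → ℝ} (ha : ∀ j, 0 < a j) (n : ℕ) :
    IsUnitMonotone (stepApprox a n) := by
  induction n generalizing a with
  | zero =>
    refine ⟨fun x y hxy => ?_, fun x => ?_, fun x => ?_⟩
    · simp only [stepApprox, indicator, mem_Ici, Pi.one_apply]
      split_ifs <;> linarith
    · simp only [stepApprox, indicator, mem_Ici, Pi.one_apply]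
      split_ifs <;> linarith
    · simp only [stepApprox, indicator, mem_Ici, Pi.one_apply]
      split_ifs <;> linarith
  | succ n ih => exact (ih fun j => ha (j + 1)).boxAverage (ha 0).le

/-- A new innermost average lowers the Heaviside function, and the outer averages preserve order.
The pointwise limit defining `smoothStep` therefore exists. -/
theorem stepApprox_succ_le {a : ℕ → ℝ} (ha : ∀ j, 0 < a j) (n : ℕ) (x : ℝ) :
    stepApprox a (n + 1) x ≤ stepApprox a n x := by
  induction n generalizing a x with
  | zero =>
    rcases lt_or_ge x 0 with hx | hx
    · have h0 : stepApprox a 0 x = 0 := by simp [stepApprox, hx]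
      rw [h0]
      refine le_of_eq ?_
      change boxAverage (a 0) ((Ici (0 : ℝ)).indicator 1) x = 0
      unfold boxAverage
      rw [intervalIntegral.integral_congr (g := fun _ => (0 : ℝ)), intervalIntegral.integral_zero]
      intro t ht
      rw [uIcc_of_le zero_le_one] at ht
      have : x < a 0 * t := by nlinarith [ha 0, ht.1]
      simp [this]
    · have h0 : stepApprox a 0 x = 1 := by simp [stepApprox, hx]
      rw [h0]
      exact (stepApprox_isUnitMonotone ha 1).le_one x
  | succ n ih =>
    exact boxAverage_le_boxAverage (stepApprox_isUnitMonotone (fun j => ha (j + 1)) (n + 1))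
      (stepApprox_isUnitMonotone (fun j => ha (j + 1)) n) (ha 0).le
      (fun y => ih (fun j => ha (j + 1)) y) x

theorem stepApprox_eq_one {a : ℕ → ℝ} (ha : ∀ j, 0 < a j) (n : ℕ) {x : ℝ}
    (hx : ∑ j ∈ Finset.range n, a j ≤ x) : stepApprox a n x = 1 := by
  induction n generalizing a x with
  | zero =>
    have : 0 ≤ x := by simpa using hx
    simp [stepApprox, this]
  | succ n ih =>
    change boxAverage (a 0) (stepApprox (fun j => a (j + 1)) n) x = 1
    unfold boxAverage
    rw [intervalIntegral.integral_congr (g := fun _ => (1 : ℝ))]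
    · simp
    · intro t ht
      rw [uIcc_of_le zero_le_one] at ht
      refine ih (fun j => ha (j + 1)) ?_
      rw [Finset.sum_range_succ'] at hx
      nlinarith [ha 0, ht.2]

/-- The Heaviside function averaged successively over intervals of lengths `a 0, a 1, …`. -/
def smoothStep (a : ℕ → ℝ) (x : ℝ) : ℝ := ⨅ n, stepApprox a n x

theorem tendsto_stepApprox {a : ℕ → ℝ} (ha : ∀ j, 0 < a j) (x : ℝ) :
    Tendsto (fun n => stepApprox a n x) atTop (𝓝 (smoothStep a x)) :=
  tendsto_atTop_ciInf (antitone_nat_of_succ_le fun n => stepApprox_succ_le ha n x)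
    ⟨0, by rintro _ ⟨n, rfl⟩; exact (stepApprox_isUnitMonotone ha n).nonneg x⟩

theorem smoothStep_isUnitMonotone {a : ℕ → ℝ} (ha : ∀ j, 0 < a j) :
    IsUnitMonotone (smoothStep a) where
  mono x y hxy := le_of_tendsto_of_tendsto' (tendsto_stepApprox ha x) (tendsto_stepApprox ha y)
    fun n => (stepApprox_isUnitMonotone ha n).mono hxy
  nonneg x := ge_of_tendsto' (tendsto_stepApprox ha x)
    fun n => (stepApprox_isUnitMonotone ha n).nonneg x
  le_one x := le_of_tendsto' (tendsto_stepApprox ha x)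
    fun n => (stepApprox_isUnitMonotone ha n).le_one x

theorem smoothStep_of_neg {a : ℕ → ℝ} (ha : ∀ j, 0 < a j) {x : ℝ} (hx : x < 0) :
    smoothStep a x = 0 := by
  refine le_antisymm ?_ ((smoothStep_isUnitMonotone ha).nonneg x)
  refine (ciInf_le ⟨0, by rintro _ ⟨n, rfl⟩; exact (stepApprox_isUnitMonotone ha n).nonneg x⟩
    0).trans_eq ?_
  simp [stepApprox, hx]

theorem smoothStep_of_tsum_le {a : ℕ → ℝ} (ha : ∀ j, 0 < a j) (hs : Summable a) {x : ℝ}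
    (hx : ∑' j, a j ≤ x) : smoothStep a x = 1 := by
  refine tendsto_nhds_unique (tendsto_stepApprox ha x) ?_
  refine tendsto_const_nhds.congr fun n => (stepApprox_eq_one ha n ?_).symm
  exact (hs.sum_le_tsum _ fun j _ => (ha j).le).trans hx

/-- Dominated convergence in the recursion for `stepApprox`. Peeling off the outermost average gains
one derivative and leaves the same construction for the shifted sequence; all later inductions run
along this shift. -/
theorem smoothStep_eq_boxAverage {a : ℕ → ℝ} (ha : ∀ j, 0 < a j) (x : ℝ) :
    smoothStep a x = boxAverage (a 0) (smoothStep fun j => a (j + 1)) x := by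
  have ha' : ∀ j, 0 < a (j + 1) := fun j => ha (j + 1)
  refine tendsto_nhds_unique ((tendsto_add_atTop_iff_nat 1).2 (tendsto_stepApprox ha x)) ?_
  refine intervalIntegral.tendsto_integral_filter_of_dominated_convergence (fun _ => (1 : ℝ))
    (Eventually.of_forall fun n => ?_) (Eventually.of_forall fun n => ?_)
    intervalIntegrable_const (Eventually.of_forall fun t _ => tendsto_stepApprox ha' _)
  · have h := (stepApprox_isUnitMonotone ha' n).mono.measurable
    exact (h.comp (by fun_prop : Measurable fun t : ℝ => x - a 0 * t)).aestronglyMeasurable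
  · refine Eventually.of_forall fun t _ => ?_
    rw [Real.norm_of_nonneg ((stepApprox_isUnitMonotone ha' n).nonneg _)]
    exact (stepApprox_isUnitMonotone ha' n).le_one _

theorem smoothStep_eq {a : ℕ → ℝ} (ha : ∀ j, 0 < a j) (x : ℝ) :
    smoothStep a x = (a 0)⁻¹ * ((∫ t in (0 : ℝ)..x, smoothStep (fun j => a (j + 1)) t) -
      ∫ t in (0 : ℝ)..(x - a 0), smoothStep (fun j => a (j + 1)) t) := by
  have hi := (smoothStep_isUnitMonotone fun j => ha (j + 1)).intervalIntegrable
  rw [smoothStep_eq_boxAverage ha, boxAverage_eq (ha 0),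
    intervalIntegral.integral_interval_sub_left (hi _ _) (hi _ _)]

theorem continuous_smoothStep {a : ℕ → ℝ} (ha : ∀ j, 0 < a j) : Continuous (smoothStep a) := by
  have hi := (smoothStep_isUnitMonotone fun j => ha (j + 1)).intervalIntegrable
  have hc := intervalIntegral.continuous_primitive hi 0
  rw [funext (smoothStep_eq ha)]
  exact continuous_const.mul (hc.sub (hc.comp (continuous_id.sub continuous_const)))

theorem hasDerivAt_smoothStep {a : ℕ → ℝ} (ha : ∀ j, 0 < a j) (x : ℝ) :
    HasDerivAt (smoothStep a) ((a 0)⁻¹ * (smoothStep (fun j => a (j + 1)) x -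
      smoothStep (fun j => a (j + 1)) (x - a 0))) x := by
  have hc := continuous_smoothStep fun j => ha (j + 1)
  have h1 := (hc.integral_hasStrictDerivAt 0 x).hasDerivAt
  have h2 := (hc.integral_hasStrictDerivAt 0 (x - a 0)).hasDerivAt.comp_sub_const x (a 0)
  rw [funext (smoothStep_eq ha)]
  exact (h1.sub h2).const_mul _

theorem deriv_smoothStep {a : ℕ → ℝ} (ha : ∀ j, 0 < a j) :
    deriv (smoothStep a) = fun x => (a 0)⁻¹ * (smoothStep (fun j => a (j + 1)) x -
      smoothStep (fun j => a (j + 1)) (x - a 0)) :=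
  funext fun x => (hasDerivAt_smoothStep ha x).deriv

theorem contDiff_smoothStep {a : ℕ → ℝ} (ha : ∀ j, 0 < a j) {n : ℕ∞} :
    ContDiff ℝ n (smoothStep a) := by
  refine ContDiff.of_le (m := n) (contDiff_infty.2 fun n => ?_) (mod_cast le_top)
  induction n generalizing a with
  | zero => exact contDiff_zero.2 (continuous_smoothStep ha)
  | succ n ih =>
    rw [Nat.cast_add, Nat.cast_one, contDiff_succ_iff_deriv]
    refine ⟨fun x => (hasDerivAt_smoothStep ha x).differentiableAt, by simp, ?_⟩
    rw [deriv_smoothStep ha]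
    have h := ih fun j => ha (j + 1)
    exact contDiff_const.mul (h.sub (h.comp (contDiff_id.sub contDiff_const)))

theorem iteratedDeriv_succ_smoothStep {a : ℕ → ℝ} (ha : ∀ j, 0 < a j) (k : ℕ) :
    iteratedDeriv (k + 1) (smoothStep a) = fun x =>
      (a 0)⁻¹ * (iteratedDeriv k (smoothStep fun j => a (j + 1)) x -
        iteratedDeriv k (smoothStep fun j => a (j + 1)) (x - a 0)) := by
  have h : ContDiff ℝ k (smoothStep fun j => a (j + 1)) :=
    contDiff_smoothStep (n := (k : ℕ∞)) fun j => ha (j + 1)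
  have h' : ContDiff ℝ k fun x => smoothStep (fun j => a (j + 1)) (x - a 0) :=
    h.comp (contDiff_id.sub contDiff_const)
  rw [iteratedDeriv_succ', deriv_smoothStep ha]
  ext x
  rw [iteratedDeriv_const_mul_field,
    iteratedDeriv_fun_sub h.contDiffAt h'.contDiffAt, iteratedDeriv_comp_sub_const]

theorem abs_iteratedDeriv_smoothStep_le {a : ℕ → ℝ} (ha : ∀ j, 0 < a j) (k : ℕ) (x : ℝ) :
    |iteratedDeriv k (smoothStep a) x| ≤ ∏ j ∈ Finset.range k, (2 * (a j)⁻¹) := by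
  induction k generalizing a x with
  | zero =>
    have h := smoothStep_isUnitMonotone ha
    simpa [abs_of_nonneg (h.nonneg x)] using h.le_one x
  | succ k ih =>
    have hs : ∀ j, 0 < a (j + 1) := fun j => ha (j + 1)
    rw [iteratedDeriv_succ_smoothStep ha, Finset.prod_range_succ', abs_mul,
      abs_of_pos (inv_pos.2 (ha 0))]
    have h1 := ih hs x
    have h2 := ih hs (x - a 0)
    have h3 := (abs_sub (iteratedDeriv k (smoothStep fun j => a (j + 1)) x)
      (iteratedDeriv k (smoothStep fun j => a (j + 1)) (x - a 0))).trans (add_le_add h1 h2)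
    calc _ ≤ (a 0)⁻¹ * _ := mul_le_mul_of_nonneg_left h3 (inv_pos.2 (ha 0)).le
      _ = _ := by ring

/-! ### The integral of the `p`-th power -/

/-- The integral `∫ |f|^p`. -/
def powIntegral {E : Type*} [NormedAddCommGroup E] (p : ℝ) (f : ℝ → E) : ℝ≥0∞ :=
  ∫⁻ x, ‖f x‖ₑ ^ p

theorem powIntegral_mono {E F : Type*} [NormedAddCommGroup E] [NormedAddCommGroup F] {p : ℝ}
    (hp : 0 ≤ p) {f : ℝ → E} {g : ℝ → F} (h : ∀ x, ‖f x‖ ≤ ‖g x‖) :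
    powIntegral p f ≤ powIntegral p g :=
  lintegral_mono fun x => ENNReal.rpow_le_rpow (enorm_le_iff_norm_le.2 (h x)) hp

/-- Since `(s + t)^p ≤ s^p + t^p` for `p ≤ 1`, errors measured by `∫ |f|^p` add without the constant
of the quasi-triangle inequality. -/
theorem powIntegral_add_le {E : Type*} [NormedAddCommGroup E] {p : ℝ} (hp : 0 ≤ p) (hp1 : p ≤ 1)
    {f : ℝ → E} (hf : AEStronglyMeasurable f volume) (g : ℝ → E) :
    powIntegral p (fun x => f x + g x) ≤ powIntegral p f + powIntegral p g := by
  unfold powIntegral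
  rw [← lintegral_add_left' (hf.enorm.pow_const p)]
  refine lintegral_mono fun x => ?_
  exact (ENNReal.rpow_le_rpow (enorm_add_le _ _) hp).trans (ENNReal.rpow_add_le_add_rpow _ _ hp hp1)

theorem powIntegral_neg {E : Type*} [NormedAddCommGroup E] (p : ℝ) (f : ℝ → E) :
    powIntegral p (fun x => -f x) = powIntegral p f := by
  simp [powIntegral]

theorem powIntegral_sub_le {E : Type*} [NormedAddCommGroup E] {p : ℝ} (hp : 0 ≤ p) (hp1 : p ≤ 1)
    {f : ℝ → E} (hf : AEStronglyMeasurable f volume) (g : ℝ → E) :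
    powIntegral p (fun x => f x - g x) ≤ powIntegral p f + powIntegral p g := by
  simp only [sub_eq_add_neg]
  exact (powIntegral_add_le hp hp1 hf _).trans_eq (by rw [powIntegral_neg])

theorem powIntegral_sum_le {E ι : Type*} [NormedAddCommGroup E] {p : ℝ} (hp : 0 < p) (hp1 : p ≤ 1)
    (s : Finset ι) {f : ι → ℝ → E} (hf : ∀ i ∈ s, AEStronglyMeasurable (f i) volume) :
    powIntegral p (fun x => ∑ i ∈ s, f i x) ≤ ∑ i ∈ s, powIntegral p (f i) := by
  classical
  induction s using Finset.induction_on with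
  | empty => simp [powIntegral, hp]
  | insert i s hi ih =>
    simp only [Finset.sum_insert hi]
    exact (powIntegral_add_le hp.le hp1 (hf i (Finset.mem_insert_self _ _)) _).trans
      (add_le_add le_rfl (ih fun j hj => hf j (Finset.mem_insert_of_mem hj)))

theorem powIntegral_smul {𝕜 E : Type*} [NormedField 𝕜] [NormedAddCommGroup E] [NormedSpace 𝕜 E]
    {p : ℝ} (hp : 0 ≤ p) (c : 𝕜) (f : ℝ → E) :
    powIntegral p (fun x => c • f x) = ENNReal.ofReal (‖c‖ ^ p) * powIntegral p f := by
  unfold powIntegral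
  rw [← lintegral_const_mul' _ _ ENNReal.ofReal_ne_top]
  refine lintegral_congr fun x => ?_
  rw [enorm_smul, ENNReal.mul_rpow_of_nonneg _ _ hp,
    ← ENNReal.ofReal_rpow_of_nonneg (norm_nonneg c) hp, ofReal_norm]

theorem powIntegral_comp_sub {E : Type*} [NormedAddCommGroup E] (p : ℝ) (f : ℝ → E) (s : ℝ) :
    powIntegral p (fun x => f (x - s)) = powIntegral p f :=
  lintegral_sub_right_eq_self (fun x => ‖f x‖ₑ ^ p) s

theorem powIntegral_le_of_bound {E : Type*} [NormedAddCommGroup E] {p : ℝ} (hp : 0 < p)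
    {f : ℝ → E} {C a b : ℝ} (hb : ∀ x, ‖f x‖ ≤ C) (h0 : ∀ x ∉ Icc a b, f x = 0) :
    powIntegral p f ≤ ENNReal.ofReal (C ^ p * (b - a)) := by
  have hC : 0 ≤ C := (norm_nonneg _).trans (hb 0)
  calc powIntegral p f ≤ ∫⁻ x, (Icc a b).indicator (fun _ => ENNReal.ofReal (C ^ p)) x := by
        refine lintegral_mono fun x => ?_
        by_cases hx : x ∈ Icc a b
        · rw [indicator_of_mem hx, ← ENNReal.ofReal_rpow_of_nonneg hC hp.le, ← ofReal_norm]
          exact ENNReal.rpow_le_rpow (ENNReal.ofReal_le_ofReal (hb x)) hp.le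
        · simp [h0 x hx, hp]
    _ = ENNReal.ofReal (C ^ p * (b - a)) := by
        rw [lintegral_indicator_const measurableSet_Icc, Real.volume_Icc,
          ENNReal.ofReal_mul (Real.rpow_nonneg hC p)]

/-- The first derivative is one bump of height at most `1 / a 0` supported in `[0, ∑ a_j]`. Each
further derivative is a difference quotient with step `a 0` of the shifted construction, which costs
a factor `2 (a 0)^(-p)`. -/
theorem powIntegral_iteratedDeriv_smoothStep_le {p : ℝ} (hp : 0 < p) (hp1 : p ≤ 1) {a : ℕ → ℝ}
    (ha : ∀ j, 0 < a j) (hs : Summable a) (k : ℕ) :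
    powIntegral p (iteratedDeriv (k + 1) (smoothStep a)) ≤ ENNReal.ofReal
      (2 ^ k * (∏ j ∈ Finset.range (k + 1), ((a j)⁻¹) ^ p) * ∑' j, a (j + k)) := by
  induction k generalizing a with
  | zero =>
    have hs' := (summable_nat_add_iff 1).2 hs
    have ha' : ∀ j, 0 < a (j + 1) := fun j => ha (j + 1)
    have hu := smoothStep_isUnitMonotone ha'
    refine (powIntegral_le_of_bound (C := (a 0)⁻¹) (a := 0) (b := ∑' j, a j) hp (fun x => ?_)
      fun x hx => ?_).trans_eq (by simp)
    · rw [iteratedDeriv_succ_smoothStep ha, norm_mul, Real.norm_eq_abs, Real.norm_eq_abs,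
        abs_of_pos (inv_pos.2 (ha 0)), iteratedDeriv_zero]
      refine mul_le_of_le_one_right (inv_pos.2 (ha 0)).le ?_
      rw [abs_le]
      constructor <;> linarith [hu.nonneg x, hu.le_one x, hu.nonneg (x - a 0), hu.le_one (x - a 0)]
    · rw [iteratedDeriv_succ_smoothStep ha, iteratedDeriv_zero]
      rw [mem_Icc, not_and_or, not_le, not_le] at hx
      rcases hx with hx | hx
      · simp [smoothStep_of_neg ha' hx, smoothStep_of_neg ha' (show x - a 0 < 0 by linarith [ha 0])]
      · rw [hs.tsum_eq_zero_add] at hx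
        beta_reduce
        rw [smoothStep_of_tsum_le ha' hs' (by linarith [ha 0]),
          smoothStep_of_tsum_le ha' hs' (by linarith)]
        simp
  | succ k ih =>
    have hs' := (summable_nat_add_iff 1).2 hs
    have ha' : ∀ j, 0 < a (j + 1) := fun j => ha (j + 1)
    rw [iteratedDeriv_succ_smoothStep ha]
    have hm : AEStronglyMeasurable (iteratedDeriv (k + 1) (smoothStep fun j => a (j + 1)))
        (volume : Measure ℝ) :=
      ((contDiff_smoothStep (n := (k + 1 : ℕ)) ha').continuous_iteratedDeriv _
        le_rfl).aestronglyMeasurable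
    have h1 := powIntegral_smul hp.le (a 0)⁻¹ fun x =>
      (iteratedDeriv (k + 1) (smoothStep fun j => a (j + 1)) x -
        iteratedDeriv (k + 1) (smoothStep fun j => a (j + 1)) (x - a 0))
    simp only [smul_eq_mul] at h1
    rw [h1, Real.norm_of_nonneg (inv_pos.2 (ha 0)).le]
    have h2 := powIntegral_sub_le hp.le hp1 hm
      fun x => iteratedDeriv (k + 1) (smoothStep fun j => a (j + 1)) (x - a 0)
    rw [powIntegral_comp_sub p (iteratedDeriv (k + 1) (smoothStep fun j => a (j + 1))) (a 0),
      ← two_mul] at h2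
    have h3 := h2.trans (mul_le_mul_right (ih ha' hs') 2)
    refine (mul_le_mul_right h3 _).trans_eq ?_
    rw [← ENNReal.ofReal_ofNat 2, ← ENNReal.ofReal_mul zero_le_two,
      ← ENNReal.ofReal_mul (Real.rpow_nonneg (inv_pos.2 (ha 0)).le p)]
    congr 1
    rw [Finset.prod_range_succ' _ (k + 1)]
    have : ∀ j, a (j + k + 1) = a (j + (k + 1)) := fun j => by rw [add_assoc]
    simp only [this]
    ring

/-! ### The choice of the lengths -/

/-- The average of `D j, D (j + 1), …` with respect to the geometric distribution. -/
def geomAverage (p : ℝ) (D : ℕ → ℝ) (j : ℕ) : ℝ := p * ∑' g, (1 - p) ^ g * D (j + g)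

section GeomAverage

variable {p : ℝ} {D : ℕ → ℝ} {B : ℝ}

theorem summable_geomAverage (hp0 : 0 < p) (hp1 : p < 1) (hD : Monotone D) (hB : ∀ j, D j ≤ B)
    (j : ℕ) : Summable fun g => (1 - p) ^ g * D (j + g) := by
  have hq0 : 0 ≤ 1 - p := by linarith
  refine Summable.of_norm_bounded (g := fun g => (1 - p) ^ g * (|D 0| + |B|))
    ((summable_geometric_of_lt_one hq0 (by linarith)).mul_right _) fun g => ?_
  rw [norm_mul, norm_pow, Real.norm_of_nonneg hq0, Real.norm_eq_abs]
  refine mul_le_mul_of_nonneg_left (abs_le.2 ⟨?_, ?_⟩) (pow_nonneg hq0 g)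
  · linarith [hD (Nat.zero_le (j + g)), neg_abs_le (D 0), abs_nonneg B]
  · linarith [hB (j + g), le_abs_self B, abs_nonneg (D 0)]

/-- Splitting off the term `g = 0`. This recursion is what makes the exponents in
`exists_box_lengths` telescope. -/
theorem geomAverage_eq (hp0 : 0 < p) (hp1 : p < 1) (hD : Monotone D) (hB : ∀ j, D j ≤ B)
    (j : ℕ) : geomAverage p D j = p * D j + (1 - p) * geomAverage p D (j + 1) := by
  unfold geomAverage
  rw [(summable_geomAverage hp0 hp1 hD hB j).tsum_eq_zero_add]
  have : ∀ g, (1 - p) ^ (g + 1) * D (j + (g + 1)) = (1 - p) * ((1 - p) ^ g * D (j + 1 + g)) :=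
    fun g => by rw [pow_succ, show j + (g + 1) = j + 1 + g by ring]; ring
  simp only [this, tsum_mul_left, pow_zero, one_mul, add_zero]
  ring

theorem geomAverage_mono (hp0 : 0 < p) (hp1 : p < 1) (hD : Monotone D) (hB : ∀ j, D j ≤ B) :
    Monotone (geomAverage p D) := by
  intro i j hij
  refine mul_le_mul_of_nonneg_left ?_ hp0.le
  refine (summable_geomAverage hp0 hp1 hD hB i).tsum_le_tsum (fun g => ?_)
    (summable_geomAverage hp0 hp1 hD hB j)
  exact mul_le_mul_of_nonneg_left (hD (by lia)) (pow_nonneg (by linarith) g)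

theorem tsum_geometric_one_sub (hp0 : 0 < p) (hp1 : p < 1) : ∑' g : ℕ, (1 - p) ^ g = p⁻¹ := by
  rw [tsum_geometric_of_lt_one (by linarith) (by linarith), sub_sub_cancel]

theorem geomAverage_le (hp0 : 0 < p) (hp1 : p < 1) (hD : Monotone D) (hB : ∀ j, D j ≤ B) (j : ℕ) :
    geomAverage p D j ≤ B := by
  have hq0 : 0 ≤ 1 - p := by linarith
  have h := (summable_geomAverage hp0 hp1 hD hB j).tsum_le_tsum
    (fun g => mul_le_mul_of_nonneg_left (hB (j + g)) (pow_nonneg hq0 g))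
    ((summable_geometric_of_lt_one hq0 (by linarith)).mul_right B)
  rw [tsum_mul_right, tsum_geometric_one_sub hp0 hp1] at h
  calc geomAverage p D j ≤ p * (p⁻¹ * B) := mul_le_mul_of_nonneg_left h hp0.le
    _ = B := mul_inv_cancel_left₀ hp0.ne' B

theorem sum_geomAverage (hp0 : 0 < p) (hp1 : p < 1) (hD : Monotone D) (hB : ∀ j, D j ≤ B) (k : ℕ) :
    p * ∑ j ∈ Finset.range k, geomAverage p D j - (1 - p) * geomAverage p D k =
      p * ∑ j ∈ Finset.range k, D j - (1 - p) * geomAverage p D 0 := by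
  induction k with
  | zero => simp
  | succ k ih =>
    rw [Finset.sum_range_succ, Finset.sum_range_succ]
    linarith [geomAverage_eq hp0 hp1 hD hB k]

/-- By monotonicity the omitted terms are at least `(1-p)^g D 0`. The correction `D 0 - |D 0|`
vanishes if `D 0 ≥ 0` and otherwise dominates their negative contribution. -/
theorem le_geomAverage_zero (hp0 : 0 < p) (hp1 : p < 1) (hD : Monotone D) (hB : ∀ j, D j ≤ B)
    (N : ℕ) :
    p * ∑ g ∈ Finset.range N, (1 - p) ^ g * D g + (D 0 - |D 0|) ≤ geomAverage p D 0 := by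
  have hq0 : 0 ≤ 1 - p := by linarith
  have hg := summable_geometric_of_lt_one hq0 (by linarith)
  have hs := summable_geomAverage hp0 hp1 hD hB 0
  simp only [zero_add] at hs
  have h1 := (hs.sub (hg.mul_right (D 0))).sum_le_tsum (Finset.range N) fun g _ => by
    rw [← mul_sub]
    exact mul_nonneg (pow_nonneg hq0 g) (sub_nonneg.2 (hD (Nat.zero_le g)))
  rw [hs.tsum_sub (hg.mul_right _), tsum_mul_right, tsum_geometric_one_sub hp0 hp1,
    Finset.sum_sub_distrib, ← Finset.sum_mul] at h1
  have h2 : ∑ g ∈ Finset.range N, (1 - p) ^ g ≤ p⁻¹ := by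
    rw [← tsum_geometric_one_sub hp0 hp1]
    exact hg.sum_le_tsum _ fun g _ => pow_nonneg hq0 g
  have h3 : (∑ g ∈ Finset.range N, (1 - p) ^ g) * D 0 ≤ p⁻¹ * |D 0| :=
    (mul_le_mul_of_nonneg_left (le_abs_self _)
      (Finset.sum_nonneg fun g _ => pow_nonneg hq0 g)).trans
      (mul_le_mul_of_nonneg_right h2 (abs_nonneg _))
  have h4 := mul_le_mul_of_nonneg_left
    (show ∑ g ∈ Finset.range N, (1 - p) ^ g * D g + p⁻¹ * D 0 - p⁻¹ * |D 0| ≤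
      ∑' g, (1 - p) ^ g * D g by linarith) hp0.le
  simp only [geomAverage, zero_add]
  refine le_trans (le_of_eq ?_) h4
  field_simp
  ring

end GeomAverage

/-- Summation by parts: it turns weighted increments of `log M` into the weighted sums of the
`p`-characteristic. -/
theorem sum_geometric_mul_sub (q : ℝ) (m : ℕ → ℝ) (N : ℕ) :
    ∑ g ∈ Finset.range N, q ^ g * (m (g + 2) - m (g + 1)) =
      q ^ N * m (N + 1) - m 1 + (1 - q) * ∑ g ∈ Finset.range N, q ^ g * m (g + 2) := by
  induction N with
  | zero => simp
  | succ N ih =>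
    rw [Finset.sum_range_succ, Finset.sum_range_succ, ih]
    ring

/-- The increments of `m`, from the first on, truncated at the `N`-th one. -/
def truncIncrement (m : ℕ → ℝ) (N j : ℕ) : ℝ := min (m (j + 2) - m (j + 1)) (m (N + 2) - m (N + 1))

/-! ### Lengths adapted to a convex sequence with divergent weighted sums -/

section Weights

variable {p ρ C : ℝ} {m : ℕ → ℝ}

theorem monotone_increment (hconv : ∀ n, 2 * m (n + 1) ≤ m n + m (n + 2)) :
    Monotone fun n => m (n + 1) - m n :=
  monotone_nat_of_le_succ fun n => by
    have := hconv n
    rw [show n + 1 + 1 = n + 2 from rfl]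
    linarith

theorem monotone_truncIncrement (hconv : ∀ n, 2 * m (n + 1) ≤ m n + m (n + 2)) (N : ℕ) :
    Monotone (truncIncrement m N) := fun i j hij =>
  min_le_min (monotone_increment hconv (show i + 1 ≤ j + 1 by lia)) le_rfl

theorem sum_truncIncrement_le (m : ℕ → ℝ) (N k : ℕ) :
    ∑ j ∈ Finset.range k, truncIncrement m N j ≤ m (k + 1) - m 1 := by
  refine (Finset.sum_le_sum fun j _ => min_le_left _ _).trans_eq ?_
  exact Finset.sum_range_sub (fun j => m (j + 1)) k

theorem exists_le_geomAverage_truncIncrement (hp0 : 0 < p) (hp1 : p < 1)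
    (hconv : ∀ n, 2 * m (n + 1) ≤ m n + m (n + 2)) (hC : ∀ n, -C ≤ m n)
    (hdiv : ∀ K, ∃ n, K ≤ ∑ j ∈ Finset.Icc 1 n, (1 - p) ^ j * m j) (K : ℝ) :
    ∃ N, K ≤ geomAverage p (truncIncrement m N) 0 := by
  have hq0 : 0 < 1 - p := by linarith
  set d := m 2 - m 1 with hd
  -- `K'` comes from solving the Abel summation inequality for the characteristic sum, with the
  -- boundary term bounded below by `-|C|`. The maximum with `1` below excludes the empty sum.
  set K' := (1 - p) ^ 2 * ((K - (d - |d|)) / p + |C| + m 1) / p + (1 - p) * m 1 with hK'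
  obtain ⟨n, hn⟩ := hdiv (max K' 1)
  obtain ⟨N, rfl⟩ : ∃ N, n = N + 1 := by
    refine Nat.exists_eq_succ_of_ne_zero ?_
    rintro rfl
    have := (le_max_right K' 1).trans hn
    norm_num at this
  refine ⟨N, ?_⟩
  have hD := monotone_truncIncrement hconv N
  have h0 : truncIncrement m N 0 = d :=
    min_eq_left (monotone_increment hconv (show 1 ≤ N + 1 by lia))
  have h1 := le_geomAverage_zero hp0 hp1 hD (fun j => min_le_right _ _) N
  rw [h0] at h1
  refine le_trans ?_ h1
  have h2 : ∑ g ∈ Finset.range N, (1 - p) ^ g * truncIncrement m N g =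
      ∑ g ∈ Finset.range N, (1 - p) ^ g * (m (g + 2) - m (g + 1)) := by
    refine Finset.sum_congr rfl fun g hg => ?_
    rw [truncIncrement, min_eq_left]
    exact monotone_increment hconv (show g + 1 ≤ N + 1 by have := Finset.mem_range.1 hg; lia)
  have h3 : ∑ j ∈ Finset.Icc 1 (N + 1), (1 - p) ^ j * m j =
      (1 - p) ^ 2 * ∑ g ∈ Finset.range N, (1 - p) ^ g * m (g + 2) + (1 - p) * m 1 := by
    rw [← Finset.Ico_add_one_right_eq_Icc, Finset.sum_Ico_eq_sum_range, Nat.add_sub_cancel,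
      Finset.sum_range_succ', Finset.mul_sum]
    congr 1
    · refine Finset.sum_congr rfl fun g _ => ?_
      rw [show 1 + (g + 1) = g + 2 by ring]
      ring
    · norm_num
  rw [h3] at hn
  rw [h2, sum_geometric_mul_sub, sub_sub_cancel]
  set S := ∑ g ∈ Finset.range N, (1 - p) ^ g * m (g + 2)
  have h4 := (le_max_left K' 1).trans hn
  have h5 : ((K - (d - |d|)) / p + |C| + m 1) / p ≤ S := by
    refine le_of_mul_le_mul_left (a := (1 - p) ^ 2) ?_ (by positivity)
    rw [← mul_div_assoc]
    linarith
  rw [div_le_iff₀ hp0] at h5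
  have h6 : -|C| ≤ (1 - p) ^ N * m (N + 1) := by
    have h7 : (1 - p) ^ N ≤ 1 := pow_le_one₀ hq0.le (by linarith)
    have h8 : 0 ≤ (1 - p) ^ N := by positivity
    nlinarith [hC (N + 1), le_abs_self C, abs_nonneg C]
  have h9 : (K - (d - |d|)) / p ≤ (1 - p) ^ N * m (N + 1) - m 1 + p * S := by linarith
  rw [div_le_iff₀ hp0] at h9
  linarith

/-- A linear term is absorbed by any positive multiple of `n log(n+1)`; this will pay for the factor
`2^k`. -/
theorem exists_mul_log_le {τ : ℝ} (hτ : 0 < τ) (c : ℝ) :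
    ∃ C', ∀ n : ℕ, c * n ≤ τ * (n * Real.log (n + 1)) + C' := by
  refine ⟨|c| * Real.exp (c / τ), fun n => ?_⟩
  have hn : (0 : ℝ) ≤ n := n.cast_nonneg
  have hlog : 0 ≤ Real.log ((n : ℝ) + 1) := Real.log_nonneg (by linarith)
  rcases le_total (c / τ) (Real.log (n + 1)) with h | h
  · rw [div_le_iff₀ hτ] at h
    nlinarith [mul_nonneg (abs_nonneg c) (Real.exp_pos (c / τ)).le]
  · have h1 : (n : ℝ) + 1 ≤ Real.exp (c / τ) := (Real.log_le_iff_le_exp (by linarith)).1 h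
    have h2 : c * n ≤ |c| * Real.exp (c / τ) :=
      mul_le_mul (le_abs_self c) (by linarith) hn (abs_nonneg c)
    nlinarith [mul_nonneg hτ.le (mul_nonneg hn hlog)]

theorem sum_log_le (k : ℕ) :
    ∑ j ∈ Finset.range k, Real.log ((j : ℝ) + 1) ≤ k * Real.log (k + 1) := by
  refine (Finset.sum_le_card_nsmul _ _ (Real.log (k + 1)) fun j hj => ?_).trans_eq (by simp)
  have : (j : ℝ) ≤ k := by exact_mod_cast (Finset.mem_range.1 hj).le
  exact Real.log_le_log (by positivity) (by linarith)

/-- The lengths are `exp(-b_j)` with `b_j = η β_j + ρ₁ log(j+1)`, where `β` is the geometric average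
of the truncated increments of `m`. A large `β_0` supplies the gain `K`; the truncation keeps `β`
bounded above and thus gives the last estimate. -/
theorem exists_box_lengths (hp0 : 0 < p) (hp1 : p < 1)
    (hconv : ∀ n, 2 * m (n + 1) ≤ m n + m (n + 2)) (hρ : 1 < ρ)
    (hm : ∀ n : ℕ, ρ * (n * Real.log (n + 1)) - C ≤ m n)
    (hdiv : ∀ K, ∃ n, K ≤ ∑ j ∈ Finset.Icc 1 n, (1 - p) ^ j * m j) (K : ℝ) :
    ∃ a : ℕ → ℝ, (∀ j, 0 < a j) ∧ Summable a ∧ ∑' j, a j ≤ Real.exp (-K) ∧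
      (∀ k, 2 ^ k * (∏ j ∈ Finset.range (k + 1), ((a j)⁻¹) ^ p) * ∑' j, a (j + k) ≤
        Real.exp (p * m (k + 1) - K)) ∧
      ∃ A, ∀ k : ℕ, ∏ j ∈ Finset.range k, (2 * (a j)⁻¹) ≤ Real.exp (A * (k + 1) ^ 2) := by
  have hlog : ∀ n : ℕ, 0 ≤ Real.log ((n : ℝ) + 1) := fun n =>
    Real.log_nonneg (by linarith [n.cast_nonneg (α := ℝ)])
  -- The budget `(1-η) ρ = ρ₁ + τ`: the part `ρ₁ > 1` pays for the logarithms in `b`, and `τ > 0`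
  -- for the powers of 2.
  set ρ₁ := (1 + ρ) / 2 with hρ₁
  set τ := (ρ - 1) / 4 with hτ
  set η := (ρ - 1) / (4 * ρ) with hη
  have hη0 : 0 < η := div_pos (by linarith) (by linarith)
  have hηρ : (1 - η) * ρ = ρ₁ + τ := by
    rw [hη, hρ₁, hτ]
    field_simp
    ring
  have hη1 : 0 ≤ 1 - η := by
    have : 0 < (1 - η) * ρ := by rw [hηρ, hρ₁, hτ]; linarith
    exact (pos_of_mul_pos_left this (by linarith)).le
  have hz : Summable fun j : ℕ => Real.exp (-(ρ₁ * Real.log ((j : ℝ) + 1))) := by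
    have h := (summable_nat_add_iff 1).2 (Real.summable_nat_rpow_inv.2 (show 1 < ρ₁ by
      rw [hρ₁]; linarith))
    refine h.congr fun j => ?_
    rw [Real.rpow_def_of_pos (by positivity), ← Real.exp_neg]
    push_cast
    ring_nf
  set Z := ∑' j : ℕ, Real.exp (-(ρ₁ * Real.log ((j : ℝ) + 1))) with hZ
  have hZ0 : 0 < Z := hz.tsum_pos (fun j => (Real.exp_pos _).le) 0 (Real.exp_pos _)
  obtain ⟨C', hC'⟩ := exists_mul_log_le (τ := p * τ) (mul_pos hp0 (by rw [hτ]; linarith))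
    (Real.log 2)
  -- The first lower bound on `β 0` makes the total length at most `exp(-K)`; the second absorbs
  -- every constant in the derivative estimate.
  obtain ⟨N, hN⟩ := exists_le_geomAverage_truncIncrement hp0 hp1 hconv (C := C)
    (fun n => le_trans (by nlinarith [mul_nonneg n.cast_nonneg (hlog n)]) (hm n)) hdiv
    (max ((K + Real.log Z) / η)
      ((Real.log Z + K + p * ((1 - η) * C) - p * η * m 1 + C') / (η * (1 - p))))
  set D := truncIncrement m N with hD
  have hDm : Monotone D := monotone_truncIncrement hconv N
  set B := m (N + 2) - m (N + 1) with hB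
  have hDB : ∀ j, D j ≤ B := fun j => min_le_right _ _
  set β := geomAverage p D with hβ
  have hβm : Monotone β := geomAverage_mono hp0 hp1 hDm hDB
  have hN1 : K + Real.log Z ≤ η * β 0 := by
    have := (le_max_left _ _).trans hN
    rwa [div_le_iff₀' hη0] at this
  have hN2 : Real.log Z + K + p * ((1 - η) * C) - p * η * m 1 + C' ≤ η * (1 - p) * β 0 := by
    have := (le_max_right _ _).trans hN
    rwa [div_le_iff₀' (mul_pos hη0 (by linarith))] at this
  set b : ℕ → ℝ := fun j => η * β j + ρ₁ * Real.log ((j : ℝ) + 1) with hb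
  have hle : ∀ k j, Real.exp (-b (j + k)) ≤
      Real.exp (-(η * β k)) * Real.exp (-(ρ₁ * Real.log ((j : ℝ) + 1))) := by
    intro k j
    rw [← Real.exp_add, Real.exp_le_exp, hb]
    have h1 : β k ≤ β (j + k) := hβm (by lia)
    have h2 : Real.log ((j : ℝ) + 1) ≤ Real.log (((j + k : ℕ) : ℝ) + 1) :=
      Real.log_le_log (by positivity) (by push_cast; linarith [k.cast_nonneg (α := ℝ)])
    have h3 : 0 < ρ₁ := by rw [hρ₁]; linarith
    nlinarith
  have hsum : ∀ k, Summable fun j => Real.exp (-b (j + k)) := fun k =>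
    Summable.of_nonneg_of_le (fun j => (Real.exp_pos _).le) (hle k) (hz.mul_left _)
  have htail : ∀ k, ∑' j, Real.exp (-b (j + k)) ≤ Real.exp (Real.log Z - η * β k) := by
    intro k
    refine ((hsum k).tsum_le_tsum (hle k) (hz.mul_left _)).trans_eq ?_
    rw [tsum_mul_left, ← hZ, sub_eq_add_neg, Real.exp_add, Real.exp_log hZ0, mul_comm]
  refine ⟨fun j => Real.exp (-b j), fun j => Real.exp_pos _, by simpa using hsum 0, ?_, ?_, ?_⟩
  · refine (by simpa using htail 0 : ∑' j, Real.exp (-b j) ≤ _).trans ?_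
    rw [Real.exp_le_exp]
    linarith
  · intro k
    have hprod : ∏ j ∈ Finset.range (k + 1), (Real.exp (-b j))⁻¹ ^ p =
        Real.exp (p * ∑ j ∈ Finset.range (k + 1), b j) := by
      rw [Finset.mul_sum, Real.exp_sum]
      refine Finset.prod_congr rfl fun j _ => ?_
      rw [← Real.exp_neg, neg_neg, ← Real.exp_mul, mul_comm]
    rw [hprod]
    have h2 : (2 : ℝ) ^ k = Real.exp (k * Real.log 2) := by
      rw [Real.exp_nat_mul, Real.exp_log two_pos]
    rw [h2, ← Real.exp_add]
    refine (mul_le_mul_of_nonneg_left (htail k) (Real.exp_pos _).le).trans ?_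
    rw [← Real.exp_add, Real.exp_le_exp]
    have hsb : ∑ j ∈ Finset.range (k + 1), b j = η * ∑ j ∈ Finset.range k, β j + η * β k +
        ρ₁ * ∑ j ∈ Finset.range (k + 1), Real.log ((j : ℝ) + 1) := by
      rw [hb, Finset.sum_add_distrib, ← Finset.mul_sum, ← Finset.mul_sum,
        Finset.sum_range_succ (fun j => β j)]
      ring
    -- The tail bound contributes `-η β_k` and the product `p η β_k`. Together they give the
    -- boundary term `-η (1-p) β_k` that telescoping needs.
    have h3 := sum_geomAverage hp0 hp1 hDm hDB k
    rw [← hβ] at h3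
    have h4 := sum_truncIncrement_le m N k
    rw [← hD] at h4
    have h5 := sum_log_le (k + 1)
    have h6 := hm (k + 1)
    have h7 := hC' (k + 1)
    push_cast at h5 h6 h7
    set L := ((k : ℝ) + 1) * Real.log ((k : ℝ) + 1 + 1) with hL
    set Sβ := ∑ j ∈ Finset.range k, β j
    set SD := ∑ j ∈ Finset.range k, D j
    set Sl := ∑ j ∈ Finset.range (k + 1), Real.log ((j : ℝ) + 1)
    rw [hsb]
    -- The share `η` of `p m(k+1)` covers the sum of the increments; the share `1 - η` covers the
    -- logarithms and, through `τ`, the factor `2^k`.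
    have h8 : (1 - η) * (ρ * L - C) ≤ (1 - η) * m (k + 1) := mul_le_mul_of_nonneg_left h6 hη1
    have h9 : p * ((1 - η) * (ρ * L - C)) ≤ p * ((1 - η) * m (k + 1)) :=
      mul_le_mul_of_nonneg_left h8 hp0.le
    have h10 : p * ((1 - η) * (ρ * L - C)) = p * ρ₁ * L + p * τ * L - p * ((1 - η) * C) := by
      rw [mul_sub, ← mul_assoc (1 - η), hηρ]; ring
    have h11 : p * η * SD ≤ p * η * (m (k + 1) - m 1) :=
      mul_le_mul_of_nonneg_left h4 (by positivity)
    have h12 : p * ρ₁ * Sl ≤ p * ρ₁ * L :=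
      mul_le_mul_of_nonneg_left h5 (mul_nonneg hp0.le (by rw [hρ₁]; linarith))
    have h13 : η * (p * Sβ - (1 - p) * β k) = η * (p * SD - (1 - p) * β 0) := by rw [h3]
    have h14 : 0 ≤ Real.log 2 := Real.log_nonneg one_le_two
    linarith
  · refine ⟨Real.log 2 + η * |B| + ρ₁, fun k => ?_⟩
    have hprod : ∏ j ∈ Finset.range k, (2 * (Real.exp (-b j))⁻¹) =
        Real.exp (∑ j ∈ Finset.range k, (Real.log 2 + b j)) := by
      rw [Real.exp_sum]
      refine Finset.prod_congr rfl fun j _ => ?_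
      rw [← Real.exp_neg, neg_neg, Real.exp_add (Real.log 2), Real.exp_log two_pos]
    rw [hprod, Real.exp_le_exp]
    have hA : 0 ≤ Real.log 2 + η * |B| + ρ₁ := by
      have : 0 ≤ Real.log 2 := Real.log_nonneg one_le_two
      have : 0 < ρ₁ := by rw [hρ₁]; linarith
      positivity
    have hk : (0 : ℝ) ≤ k := k.cast_nonneg
    refine (Finset.sum_le_card_nsmul _ _ ((Real.log 2 + η * |B| + ρ₁) * (k + 1))
      fun j hj => ?_).trans ?_
    · have h1 : β j ≤ |B| := (geomAverage_le hp0 hp1 hDm hDB j).trans (le_abs_self B)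
      have h2 : Real.log ((j : ℝ) + 1) ≤ k := by
        have h3 := Real.log_le_sub_one_of_pos (show (0 : ℝ) < (j : ℝ) + 1 by positivity)
        have : (j : ℝ) ≤ k := by exact_mod_cast (Finset.mem_range.1 hj).le
        linarith
      have h3 : η * β j ≤ η * |B| := mul_le_mul_of_nonneg_left h1 hη0.le
      have h4 : ρ₁ * Real.log ((j : ℝ) + 1) ≤ ρ₁ * k :=
        mul_le_mul_of_nonneg_left h2 (by rw [hρ₁]; linarith)
      have h5 : 0 ≤ (Real.log 2 + η * |B|) * k := by
        have : 0 ≤ Real.log 2 := Real.log_nonneg one_le_two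
        positivity
      have h6 : 0 < ρ₁ := by rw [hρ₁]; linarith
      simp only [hb]
      linarith
    · rw [Finset.card_range, nsmul_eq_mul]
      nlinarith

end Weights

/-! ### Consequences of `p`-regularity -/

namespace IsPRegular

variable {p : ℝ} {M : ℕ → ℝ}

theorem exists_le_sum (hM : IsPRegular p M) (K : ℝ) :
    ∃ n, K ≤ ∑ j ∈ Finset.Icc 1 n, (1 - p) ^ j * Real.log (M j) := by
  by_contra! h
  have h1 : pCharacteristic p M ≤ (K : EReal) :=
    limsup_le_of_le (h := Eventually.of_forall fun n => EReal.coe_le_coe_iff.2 (h n).le)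
  rw [hM.char_eq_top] at h1
  exact absurd h1 (not_le.2 (EReal.coe_lt_top K))

theorem monotone_log_sub (hM : IsPRegular p M) :
    Monotone fun n => Real.log (M (n + 1)) - Real.log (M n) :=
  monotone_increment (m := fun n => Real.log (M n)) hM.logConvex

theorem exists_log_lt (hM : IsPRegular p M) (hp0 : 0 < p) (hp1 : p < 1) :
    ∃ j, Real.log (M j) < Real.log (M (j + 1)) := by
  by_contra! h
  have hanti : Antitone fun j => Real.log (M j) := antitone_nat_of_succ_le h
  have hq0 : 0 ≤ 1 - p := by linarith
  have hg := summable_geometric_of_lt_one hq0 (by linarith : 1 - p < 1)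
  obtain ⟨n, hn⟩ := hM.exists_le_sum (p⁻¹ * |Real.log (M 0)| + 1)
  have h1 : ∑ j ∈ Finset.Icc 1 n, (1 - p) ^ j * Real.log (M j) ≤
      ∑ j ∈ Finset.Icc 1 n, (1 - p) ^ j * |Real.log (M 0)| :=
    Finset.sum_le_sum fun j _ => mul_le_mul_of_nonneg_left
      ((hanti (Nat.zero_le j)).trans (le_abs_self _)) (pow_nonneg hq0 j)
  rw [← Finset.sum_mul] at h1
  have h2 := hg.sum_le_tsum (Finset.Icc 1 n) fun g _ => pow_nonneg hq0 g
  rw [tsum_geometric_one_sub hp0 hp1] at h2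
  nlinarith [mul_le_mul_of_nonneg_right h2 (abs_nonneg (Real.log (M 0)))]

/-- Infinite characteristic forces one positive increment of `log M`, and convexity propagates it to
linear growth. -/
theorem tendsto_log (hM : IsPRegular p M) (hp0 : 0 < p) (hp1 : p < 1) :
    Tendsto (fun n => Real.log (M n)) atTop atTop := by
  obtain ⟨j, hj⟩ := hM.exists_log_lt hp0 hp1
  rw [← tendsto_add_atTop_iff_nat j]
  set d := Real.log (M (j + 1)) - Real.log (M j) with hd
  have hd0 : 0 < d := sub_pos.2 hj
  have h : ∀ n : ℕ, Real.log (M j) + n * d ≤ Real.log (M (n + j)) := by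
    intro n
    induction n with
    | zero => simp
    | succ n ih =>
      have := hM.monotone_log_sub (show j ≤ n + j by lia)
      beta_reduce at this
      rw [show n + 1 + j = n + j + 1 by ring]
      push_cast
      linarith
  refine tendsto_atTop_mono h ?_
  exact tendsto_atTop_add_const_left _ _ (tendsto_natCast_atTop_atTop.atTop_mul_const hd0)

/-- In case (i) `log M_n` eventually exceeds a multiple of `(1-p)^(-n)`, which beats `n^2`. In case
(ii) `ρ` is the inverse of a number in `[1/2, 1)` above `δ`. -/
theorem eventually_mul_log_le (hM : IsPRegular p M) (hp0 : 0 < p) (hp1 : p < 1) :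
    ∃ ρ, 1 < ρ ∧ ∀ᶠ n : ℕ in atTop, ρ * (n * Real.log n) ≤ Real.log (M n) := by
  rcases hM.regular with h | ⟨-, δ, hδ, e, he, h⟩
  · refine ⟨2, one_lt_two, ?_⟩
    obtain ⟨c, hc0, hc⟩ := EReal.lt_iff_exists_real_btwn.1 h
    have hc0' : 0 < c := by exact_mod_cast hc0
    have hq0 : 0 < 1 - p := by linarith
    have h1 := eventually_lt_of_lt_liminf hc
    have h2 := (tendsto_pow_const_div_const_pow_of_one_lt 2
      ((one_lt_inv₀ hq0).2 (by linarith))).eventually_lt_const (show 0 < c / 2 by linarith)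
    filter_upwards [h1, h2] with n h3 h4
    have h3' : c < (1 - p) ^ n * Real.log (M n) := by exact_mod_cast h3
    rw [inv_pow, div_inv_eq_mul] at h4
    have h5 : Real.log n ≤ n := Real.log_le_self n.cast_nonneg
    have h6 : (n : ℝ) * Real.log n ≤ n ^ 2 := by
      rw [pow_two]; exact mul_le_mul_of_nonneg_left h5 n.cast_nonneg
    have h7 : 0 < (1 - p) ^ n := pow_pos hq0 n
    refine le_of_mul_le_mul_left (a := (1 - p) ^ n) ?_ h7
    nlinarith
  · set δ' := max ((1 + δ) / 2) (1 / 2) with hδ'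
    have h0 : 0 < δ' := lt_of_lt_of_le (by norm_num) (le_max_right _ _)
    have h1 : δ' < 1 := max_lt (by linarith) (by norm_num)
    refine ⟨δ'⁻¹, (one_lt_inv₀ h0).2 h1, ?_⟩
    filter_upwards [h, he.eventually_lt_const (show 0 < (1 - δ) / 2 by linarith),
      (hM.tendsto_log hp0 hp1).eventually_ge_atTop 0] with n h2 h3 h4
    rw [inv_mul_le_iff₀ h0]
    refine h2.trans (mul_le_mul_of_nonneg_right ?_ h4)
    linarith [le_max_left ((1 + δ) / 2) (1 / 2)]

/-- Replacing `log n` by `log(n+1)` costs at most `ρ n · (1/n) = ρ`; the finitely many remaining `n`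
go into `C`. -/
theorem exists_mul_log_sub_le (hM : IsPRegular p M) (hp0 : 0 < p) (hp1 : p < 1) :
    ∃ ρ C, 1 < ρ ∧ ∀ n : ℕ, ρ * (n * Real.log (n + 1)) - C ≤ Real.log (M n) := by
  obtain ⟨ρ, hρ, h⟩ := hM.eventually_mul_log_le hp0 hp1
  have h1 : IsBoundedUnder (· ≤ ·) atTop
      fun n : ℕ => ρ * (n * Real.log ((n : ℝ) + 1)) - Real.log (M n) := by
    refine ⟨ρ, eventually_map.2 ?_⟩
    filter_upwards [h, eventually_ge_atTop 1] with n h2 h3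
    have hn : (0 : ℝ) < n := by exact_mod_cast h3
    have h4 : Real.log ((n : ℝ) + 1) ≤ Real.log n + (n : ℝ)⁻¹ := by
      have h5 := Real.log_le_sub_one_of_pos (show (0 : ℝ) < (n + 1) / n by positivity)
      rw [Real.log_div (by positivity) hn.ne', add_div, div_self hn.ne'] at h5
      rw [inv_eq_one_div]
      linarith
    have h6 : (n : ℝ) * Real.log ((n : ℝ) + 1) ≤ n * Real.log n + 1 := by
      have := mul_le_mul_of_nonneg_left h4 hn.le
      rwa [mul_add, mul_inv_cancel₀ hn.ne'] at this
    nlinarith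
  obtain ⟨C, hC⟩ := h1.bddAbove_range
  exact ⟨ρ, C, hρ, fun n => by linarith [hC (mem_range_self n)]⟩

/-- By convexity the `k`-th increment is at least the mean of the previous ones, `(log M_k - log
M_0) / k`. The second summand of `C₁` serves `k = 0`. -/
theorem exists_log_increment (hM : IsPRegular p M) (hp0 : 0 < p) (hp1 : p < 1) :
    ∃ C, 0 ≤ C ∧ ∀ k : ℕ, Real.log (k + 1) - C ≤ Real.log (M (k + 1)) - Real.log (M k) := by
  obtain ⟨ρ, C, hρ, h⟩ := hM.exists_mul_log_sub_le hp0 hp1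
  set C₁ := |C + Real.log (M 0)| + |Real.log (M 1) - Real.log (M 0)| with hC₁
  refine ⟨C₁, by positivity, fun k => ?_⟩
  rcases Nat.eq_zero_or_pos k with rfl | hk
  · simp only [Nat.cast_zero, zero_add, Real.log_one, hC₁]
    linarith [neg_abs_le (Real.log (M 1) - Real.log (M 0)), abs_nonneg (C + Real.log (M 0))]
  · have hk1 : (1 : ℝ) ≤ k := by exact_mod_cast hk
    have h1 : Real.log (M k) - Real.log (M 0) ≤
        k * (Real.log (M (k + 1)) - Real.log (M k)) := by
      rw [← Finset.sum_range_sub (fun j => Real.log (M j))]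
      refine (Finset.sum_le_card_nsmul _ _ _ fun j hj =>
        hM.monotone_log_sub (Finset.mem_range.1 hj).le).trans_eq (by simp)
    have h2 := h k
    have hlog : 0 ≤ Real.log ((k : ℝ) + 1) := Real.log_nonneg (by linarith)
    have h3 : (k : ℝ) * (Real.log (k + 1) - C₁) ≤
        k * (Real.log (M (k + 1)) - Real.log (M k)) := by
      have h4 : (k : ℝ) * Real.log (k + 1) ≤ ρ * (k * Real.log (k + 1)) :=
        le_mul_of_one_le_left (by positivity) hρ.le
      have h5 : C + Real.log (M 0) ≤ C₁ := by
        linarith [le_abs_self (C + Real.log (M 0)), abs_nonneg (Real.log (M 1) - Real.log (M 0))]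
      have h6 : C₁ ≤ k * C₁ := le_mul_of_one_le_left (by positivity) hk1
      linarith
    exact le_of_mul_le_mul_left h3 (by linarith)

theorem exists_succ_mul_le (hM : IsPRegular p M) (hp0 : 0 < p) (hp1 : p < 1) :
    ∃ c, 1 ≤ c ∧ ∀ k : ℕ, (k + 1) * M k ≤ c * M (k + 1) := by
  obtain ⟨C, hC0, hC⟩ := hM.exists_log_increment hp0 hp1
  refine ⟨Real.exp C, Real.one_le_exp hC0, fun k => ?_⟩
  have h := hC k
  have hk : (0 : ℝ) < k + 1 := by positivity
  rw [← Real.exp_log hk, ← Real.exp_log (hM.pos k), ← Real.exp_log (hM.pos (k + 1)),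
    ← Real.exp_add, ← Real.exp_add, Real.exp_le_exp]
  linarith

/-- Passing from `i` to `i + 1` multiplies the binomial coefficient by at most `k - i`, and `(k-i)
M_(k-i-1) ≤ c M_(k-i)` absorbs this factor. -/
theorem exists_choose_mul_le (hM : IsPRegular p M) (hp0 : 0 < p) (hp1 : p < 1) :
    ∃ c, 1 ≤ c ∧ ∀ k i : ℕ, i ≤ k → k.choose i * M (k - i) ≤ c ^ i * M k := by
  obtain ⟨c, hc1, hc⟩ := hM.exists_succ_mul_le hp0 hp1
  refine ⟨c, hc1, fun k i => ?_⟩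
  induction i with
  | zero => simp
  | succ i ih =>
    intro hik
    obtain ⟨l, hl⟩ : ∃ l, k = l + 1 + i := ⟨k - (i + 1), by lia⟩
    have h1 := ih (by lia)
    have h2 : (k.choose (i + 1) : ℝ) * (i + 1) = k.choose i * (l + 1) := by
      have := Nat.choose_succ_right_eq k i
      rw [show k - i = l + 1 by lia] at this
      exact_mod_cast this
    have h3 := hc l
    rw [show k - i = l + 1 by lia] at h1
    rw [show k - (i + 1) = l by lia]
    have hMl := hM.pos l
    calc (k.choose (i + 1) : ℝ) * M l ≤ k.choose (i + 1) * (i + 1) * M l := by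
          gcongr
          exact le_mul_of_one_le_right (by positivity) (by linarith [i.cast_nonneg (α := ℝ)])
      _ = k.choose i * ((l + 1) * M l) := by rw [h2]; ring
      _ ≤ k.choose i * (c * M (l + 1)) := by gcongr
      _ = c * (k.choose i * M (l + 1)) := by ring
      _ ≤ c * (c ^ i * M k) := by gcongr
      _ = c ^ (i + 1) * M k := by ring

/-- Smooth approximations of the Heaviside function, with derivatives that are small in `L^p`. -/
theorem exists_smoothStep (hM : IsPRegular p M) (hp0 : 0 < p) (hp1 : p < 1) {ε : ℝ} (hε : 0 < ε) :
    ∃ H : ℝ → ℝ, ContDiff ℝ (⊤ : ℕ∞) H ∧ IsUnitMonotone H ∧ (∀ x < 0, H x = 0) ∧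
      (∀ x, ε ≤ x → H x = 1) ∧
      (∀ k, powIntegral p (iteratedDeriv (k + 1) H) ≤ ENNReal.ofReal (ε * M (k + 1) ^ p)) ∧
      ∃ A, ∀ (k : ℕ) (x : ℝ), |iteratedDeriv k H x| ≤ Real.exp (A * (k + 1) ^ 2) := by
  obtain ⟨ρ, C, hρ, h⟩ := hM.exists_mul_log_sub_le hp0 hp1
  -- With `K = -log ε`, the factor `exp(-K) = ε` bounds both the transition width and the size of
  -- the derivatives.
  obtain ⟨a, ha0, has, haε, hak, A, hA⟩ := exists_box_lengths (m := fun n => Real.log (M n))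
    hp0 hp1 hM.logConvex hρ h hM.exists_le_sum (-Real.log ε)
  refine ⟨smoothStep a, contDiff_smoothStep ha0, smoothStep_isUnitMonotone ha0,
    fun x hx => smoothStep_of_neg ha0 hx, fun x hx => smoothStep_of_tsum_le ha0 has ?_,
    fun k => ?_, A, fun k x => (abs_iteratedDeriv_smoothStep_le ha0 k x).trans (hA k)⟩
  · rw [neg_neg, Real.exp_log hε] at haε
    exact haε.trans hx
  · refine (powIntegral_iteratedDeriv_smoothStep_le hp0 hp1.le ha0 has k).trans
      (ENNReal.ofReal_le_ofReal ((hak k).trans_eq ?_))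
    rw [sub_neg_eq_add, add_comm, Real.exp_add, Real.exp_log hε,
      Real.rpow_def_of_pos (hM.pos _), mul_comm p]

end IsPRegular

/-! ### Building blocks -/

/-- Smooth functions whose derivatives of order `k` are bounded by `exp (A (k + 1)²)`. -/
def HasSlowDerivs {E : Type*} [NormedAddCommGroup E] [NormedSpace ℝ E] (g : ℝ → E) : Prop :=
  ContDiff ℝ (⊤ : ℕ∞) g ∧
    ∃ A : ℝ, ∀ (k : ℕ) (x : ℝ), ‖iteratedDeriv k g x‖ ≤ Real.exp (A * (k + 1) ^ 2)

theorem continuous_iteratedDeriv_of_smooth {E : Type*} [NormedAddCommGroup E] [NormedSpace ℝ E]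
    {g : ℝ → E} (hg : ContDiff ℝ (⊤ : ℕ∞) g) (k : ℕ) : Continuous (iteratedDeriv k g) :=
  hg.continuous_iteratedDeriv k (mod_cast le_top)

theorem iteratedDeriv_pow_div_factorial (n i : ℕ) (x : ℝ) :
    iteratedDeriv i (fun x : ℝ => x ^ n / n.factorial) x =
      n.descFactorial i / n.factorial * x ^ (n - i) := by
  simp only [div_eq_inv_mul]
  rw [iteratedDeriv_const_mul_field, iteratedDeriv_pow]
  ring

theorem descFactorial_div_factorial_le_one (n i : ℕ) :
    (n.descFactorial i : ℝ) / n.factorial ≤ 1 := by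
  rw [div_le_one (by exact_mod_cast n.factorial_pos)]
  rcases le_or_gt i n with h | h
  · rw [← Nat.factorial_mul_descFactorial h]
    exact_mod_cast Nat.le_mul_of_pos_left _ (Nat.factorial_pos _)
  · rw [Nat.descFactorial_eq_zero_iff_lt.2 h]
    simp

/-! ### Plateaus, monomial bumps and their Leibniz terms -/

section Bump

variable {H : ℝ → ℝ} {h r : ℝ}

theorem iteratedDeriv_sub_comp_sub (hH : ContDiff ℝ (⊤ : ℕ∞) H) (h : ℝ) (k : ℕ) :
    iteratedDeriv k (fun x => H x - H (x - h)) =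
      fun x => iteratedDeriv k H x - iteratedDeriv k H (x - h) := by
  have h1 : ContDiff ℝ k H := hH.of_le (mod_cast le_top)
  have h2 : ContDiff ℝ k fun x => H (x - h) := h1.comp (contDiff_id.sub contDiff_const)
  ext x
  rw [iteratedDeriv_fun_sub h1.contDiffAt h2.contDiffAt, iteratedDeriv_comp_sub_const]

theorem iteratedDeriv_sub_comp_sub_eq_zero (h0 : ∀ x < 0, H x = 0) (h1 : ∀ x, r ≤ x → H x = 1)
    (hh : 0 ≤ h) (k : ℕ) {x : ℝ} (hx : x ∉ Icc 0 (h + r)) :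
    iteratedDeriv k (fun x => H x - H (x - h)) x = 0 := by
  have : (fun x => H x - H (x - h)) =ᶠ[𝓝 x] fun _ => (0 : ℝ) := by
    rw [mem_Icc, not_and_or, not_le, not_le] at hx
    rcases hx with hx | hx
    · filter_upwards [gt_mem_nhds hx] with y hy
      rw [h0 y hy, h0 _ (by linarith), sub_zero]
    · filter_upwards [lt_mem_nhds hx] with y hy
      rw [h1 y (by linarith), h1 _ (by linarith), sub_self]
  rw [this.iteratedDeriv_eq]
  simp

/-- The product of the plateau `H x - H (x - h)` with the monomial `x ^ n / n!`. -/
def monomialBump (H : ℝ → ℝ) (h : ℝ) (n : ℕ) (x : ℝ) : ℝ :=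
  x ^ n / n.factorial * (H x - H (x - h))

/-- The `i`-th term of the Leibniz formula for the `k`-th derivative of `monomialBump H h n`. -/
def leibnizTerm (H : ℝ → ℝ) (h : ℝ) (n k i : ℕ) (x : ℝ) : ℝ :=
  k.choose i * (n.descFactorial i / n.factorial * x ^ (n - i)) *
    iteratedDeriv (k - i) (fun x => H x - H (x - h)) x

theorem contDiff_plateau (hH : ContDiff ℝ (⊤ : ℕ∞) H) (h : ℝ) :
    ContDiff ℝ (⊤ : ℕ∞) fun x => H x - H (x - h) :=
  hH.sub (hH.comp (contDiff_id.sub contDiff_const))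

theorem contDiff_monomialBump (hH : ContDiff ℝ (⊤ : ℕ∞) H) (h : ℝ) (n : ℕ) :
    ContDiff ℝ (⊤ : ℕ∞) (monomialBump H h n) :=
  ((contDiff_id.pow n).div_const _).mul (contDiff_plateau hH h)

theorem continuous_leibnizTerm (hH : ContDiff ℝ (⊤ : ℕ∞) H) (h : ℝ) (n k i : ℕ) :
    Continuous (leibnizTerm H h n k i) := by
  have := continuous_iteratedDeriv_of_smooth (contDiff_plateau hH h) (k - i)
  unfold leibnizTerm
  fun_prop

theorem iteratedDeriv_monomialBump (hH : ContDiff ℝ (⊤ : ℕ∞) H) (h : ℝ) (n k : ℕ) (x : ℝ) :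
    iteratedDeriv k (monomialBump H h n) x =
      ∑ i ∈ Finset.range (k + 1), leibnizTerm H h n k i x := by
  have h1 : ContDiff ℝ k fun x : ℝ => x ^ n / (n.factorial : ℝ) :=
    (contDiff_id.pow n).div_const _
  have h2 : ContDiff ℝ k fun x => H x - H (x - h) :=
    (contDiff_plateau hH h).of_le (mod_cast le_top)
  unfold monomialBump
  rw [iteratedDeriv_fun_mul h1.contDiffAt h2.contDiffAt]
  simp only [iteratedDeriv_pow_div_factorial, leibnizTerm]

theorem leibnizTerm_eq_zero {n i : ℕ} (hi : n < i) (k : ℕ) (x : ℝ) :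
    leibnizTerm H h n k i x = 0 := by
  simp [leibnizTerm, Nat.descFactorial_eq_zero_iff_lt.2 hi]

/-- The derivatives of the plateau vanish off `[0, h + r] ⊆ [0, 1]`, and on that interval the
monomial factor is at most 1. -/
theorem abs_leibnizTerm_le (h0 : ∀ x < 0, H x = 0) (h1 : ∀ x, r ≤ x → H x = 1) (hh : 0 ≤ h)
    (hr : h + r ≤ 1) (n k i : ℕ) (x : ℝ) :
    |leibnizTerm H h n k i x| ≤
      k.choose i * |iteratedDeriv (k - i) (fun x => H x - H (x - h)) x| := by
  unfold leibnizTerm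
  by_cases hx : x ∈ Icc 0 (h + r)
  · rw [abs_mul, abs_mul, Nat.abs_cast]
    refine mul_le_mul_of_nonneg_right (mul_le_of_le_one_right (Nat.cast_nonneg _) ?_) (abs_nonneg _)
    have h2 : 0 ≤ x ^ (n - i) := pow_nonneg hx.1 _
    rw [abs_of_nonneg (by positivity)]
    exact mul_le_one₀ (descFactorial_div_factorial_le_one n i) h2
      (pow_le_one₀ hx.1 (hx.2.trans hr))
  · rw [iteratedDeriv_sub_comp_sub_eq_zero h0 h1 hh _ hx]
    simp

theorem hasSlowDerivs_monomialBump (hH : HasSlowDerivs H) (h0 : ∀ x < 0, H x = 0)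
    (h1 : ∀ x, r ≤ x → H x = 1) (hh : 0 ≤ h) (hr : h + r ≤ 1) (n : ℕ) :
    HasSlowDerivs (monomialBump H h n) := by
  obtain ⟨hH, A, hA⟩ := hH
  refine ⟨contDiff_monomialBump hH h n, |A| + Real.log 2, fun k x => ?_⟩
  have hA' : ∀ j ≤ k, ∀ x, |iteratedDeriv j H x| ≤ Real.exp (|A| * (k + 1) ^ 2) := by
    intro j hj x
    refine (hA j x).trans (Real.exp_le_exp.2 ?_)
    have : (j : ℝ) ≤ k := by exact_mod_cast hj
    calc A * ((j : ℝ) + 1) ^ 2 ≤ |A| * ((j : ℝ) + 1) ^ 2 := by gcongr; exact le_abs_self A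
      _ ≤ |A| * ((k : ℝ) + 1) ^ 2 := by gcongr
  rw [iteratedDeriv_monomialBump hH, Real.norm_eq_abs]
  calc |∑ i ∈ Finset.range (k + 1), leibnizTerm H h n k i x|
      ≤ ∑ i ∈ Finset.range (k + 1), |leibnizTerm H h n k i x| := Finset.abs_sum_le_sum_abs _ _
    _ ≤ ∑ i ∈ Finset.range (k + 1), k.choose i * (2 * Real.exp (|A| * (k + 1) ^ 2)) := by
        refine Finset.sum_le_sum fun i _ => (abs_leibnizTerm_le h0 h1 hh hr n k i x).trans ?_
        refine mul_le_mul_of_nonneg_left ?_ (Nat.cast_nonneg _)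
        rw [iteratedDeriv_sub_comp_sub hH, two_mul]
        exact (abs_sub _ _).trans (add_le_add (hA' _ (Nat.sub_le _ _) _) (hA' _ (Nat.sub_le _ _) _))
    _ = Real.exp ((k + 1) * Real.log 2 + |A| * (k + 1) ^ 2) := by
        rw [← Finset.sum_mul, ← Nat.cast_sum, Nat.sum_range_choose, Real.exp_add, add_mul, one_mul,
          Real.exp_add, Real.exp_nat_mul, Real.exp_log two_pos]
        push_cast
        ring
    _ ≤ Real.exp ((|A| + Real.log 2) * (k + 1) ^ 2) := by
        rw [Real.exp_le_exp]
        have h2 : 0 ≤ Real.log 2 := Real.log_nonneg one_le_two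
        have h3 : (k : ℝ) + 1 ≤ (k + 1) ^ 2 := by nlinarith [k.cast_nonneg (α := ℝ)]
        nlinarith

/-- `H` differs from the Heaviside function only on `[0, r]`, by at most 1; plateau and indicator
are the respective differences with the translate by `h`. -/
theorem powIntegral_plateau_sub_indicator_le {p : ℝ} (hp0 : 0 < p) (hp1 : p ≤ 1)
    (hc : Continuous H) (hu : IsUnitMonotone H)
    (h0 : ∀ x < 0, H x = 0) (h1 : ∀ x, r ≤ x → H x = 1) (hh : 0 ≤ h) :
    powIntegral p (fun x => H x - H (x - h) - (Ico 0 h).indicator (fun _ => (1 : ℝ)) x) ≤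
      ENNReal.ofReal (2 * r) := by
  set u : ℝ → ℝ := fun x => H x - (Ici 0).indicator (fun _ => (1 : ℝ)) x with hu'
  have hum : Measurable u := hc.measurable.sub (measurable_const.indicator measurableSet_Ici)
  have h2 : powIntegral p u ≤ ENNReal.ofReal r := by
    refine (powIntegral_le_of_bound (C := 1) (a := 0) (b := r) hp0 (fun x => ?_)
      fun x hx => ?_).trans_eq (by simp)
    · rw [Real.norm_eq_abs, abs_le]
      simp only [hu', indicator, mem_Ici]
      split_ifs <;> constructor <;> linarith [hu.nonneg x, hu.le_one x]
    · rw [mem_Icc, not_and_or, not_le, not_le] at hx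
      rcases lt_or_ge x 0 with hx0 | hx0
      · simp [hu', h0 x hx0, hx0]
      · have : r < x := hx.resolve_left (not_lt.2 hx0)
        simp [hu', h1 x this.le, hx0]
  have h3 : (fun x => H x - H (x - h) - (Ico 0 h).indicator (fun _ => (1 : ℝ)) x) =
      fun x => u x - u (x - h) := by
    ext x
    simp only [hu', indicator, mem_Ico, mem_Ici, sub_nonneg]
    rcases lt_or_ge x 0 with hx0 | hx0
    · have : ¬ h ≤ x := not_le.2 (hx0.trans_le hh)
      simp [hx0.not_ge, this]
    · rcases lt_or_ge x h with hx1 | hx1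
      · simp [hx0, hx1, hx1.not_ge]
        ring
      · simp [hx0, hx1, hx1.not_gt]
  rw [h3]
  refine (powIntegral_sub_le hp0.le hp1 hum.aestronglyMeasurable _).trans ?_
  rw [powIntegral_comp_sub, ← two_mul, ENNReal.ofReal_mul zero_le_two, ENNReal.ofReal_ofNat]
  gcongr

end Bump

/-! ### Size of the Leibniz terms and the bump -/

section Approximation

variable {p : ℝ} {M : ℕ → ℝ}

/-- As `i < k`, the plateau is differentiated at least once, so the smallness `δ` enters; the factor
`c^i ≤ c^n` is uniform in `k`. -/
theorem powIntegral_leibnizTerm_le (hp0 : 0 < p) (hp1 : p < 1) (hMpos : ∀ n, 0 < M n)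
    {c : ℝ} (hc1 : 1 ≤ c)
    (hc : ∀ k i : ℕ, i ≤ k → k.choose i * M (k - i) ≤ c ^ i * M k) {H : ℝ → ℝ} {h r δ : ℝ}
    (hH : ContDiff ℝ (⊤ : ℕ∞) H) (h0 : ∀ x < 0, H x = 0)
    (h1 : ∀ x, r ≤ x → H x = 1) (hh : 0 ≤ h) (hr : h + r ≤ 1) (hδ : 0 < δ)
    (hHδ : ∀ k, powIntegral p (iteratedDeriv (k + 1) H) ≤ ENNReal.ofReal (δ * M (k + 1) ^ p))
    {n k i : ℕ} (hi : i ≤ n) (hik : i < k) :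
    powIntegral p (leibnizTerm H h n k i) ≤
      ENNReal.ofReal (2 * δ * (c ^ n) ^ p * M k ^ p) := by
  have h2 : powIntegral p (leibnizTerm H h n k i) ≤ powIntegral p fun x =>
      (k.choose i : ℝ) • iteratedDeriv (k - i) (fun x => H x - H (x - h)) x := by
    refine powIntegral_mono hp0.le fun x => ?_
    rw [norm_smul, Real.norm_eq_abs, Real.norm_eq_abs, Real.norm_eq_abs, Nat.abs_cast]
    exact abs_leibnizTerm_le h0 h1 hh hr n k i x
  have h3 : powIntegral p (iteratedDeriv (k - i) fun x => H x - H (x - h)) ≤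
      ENNReal.ofReal (2 * (δ * M (k - i) ^ p)) := by
    rw [iteratedDeriv_sub_comp_sub hH]
    have hm := (continuous_iteratedDeriv_of_smooth hH (k - i)).aestronglyMeasurable
      (μ := (volume : Measure ℝ))
    refine (powIntegral_sub_le hp0.le hp1.le hm _).trans ?_
    rw [powIntegral_comp_sub p (iteratedDeriv (k - i) H), ← two_mul,
      ENNReal.ofReal_mul zero_le_two, ENNReal.ofReal_ofNat]
    gcongr
    obtain ⟨l, hl⟩ : ∃ l, k - i = l + 1 := ⟨k - i - 1, by lia⟩
    rw [hl]
    exact hHδ l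
  refine h2.trans ?_
  rw [powIntegral_smul hp0.le]
  refine (mul_le_mul_right h3 _).trans ?_
  rw [Real.norm_natCast, ← ENNReal.ofReal_mul (by positivity)]
  refine ENNReal.ofReal_le_ofReal ?_
  have h4 : ((k.choose i : ℝ) * M (k - i)) ^ p ≤ (c ^ n * M k) ^ p := by
    refine Real.rpow_le_rpow (mul_nonneg (Nat.cast_nonneg _) (hMpos _).le) ?_ hp0.le
    refine (hc k i hik.le).trans (mul_le_mul_of_nonneg_right ?_ (hMpos k).le)
    exact pow_le_pow_right₀ hc1 hi
  rw [Real.mul_rpow (Nat.cast_nonneg _) (hMpos _).le,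
    Real.mul_rpow (by positivity) (hMpos _).le] at h4
  nlinarith

/-- A positive power of `x` survives when `k < n`, so the term is at most `2h` on an interval of
length `2h`. This error does not shrink with `δ`, only with `h`. -/
theorem powIntegral_leibnizTerm_self_le (hp0 : 0 < p) {H : ℝ → ℝ} {h r : ℝ}
    (hu : IsUnitMonotone H) (h0 : ∀ x < 0, H x = 0) (h1 : ∀ x, r ≤ x → H x = 1)
    (hh : 0 < h) (hh2 : 2 * h ≤ 1) (hr : r ≤ h) {n k : ℕ} (hk : k < n) :
    powIntegral p (leibnizTerm H h n k k) ≤ ENNReal.ofReal ((2 * h) ^ p * (2 * h)) := by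
  have hz : ∀ x ∉ Icc 0 (2 * h), leibnizTerm H h n k k x = 0 := by
    intro x hx
    have hx' : x ∉ Icc 0 (h + r) := fun hx' => hx ⟨hx'.1, hx'.2.trans (by linarith)⟩
    rw [leibnizTerm, iteratedDeriv_sub_comp_sub_eq_zero h0 h1 hh.le _ hx', mul_zero]
  refine (powIntegral_le_of_bound (C := 2 * h) hp0 (fun x => ?_) hz).trans_eq (by rw [sub_zero])
  by_cases hx : x ∈ Icc 0 (2 * h)
  · rw [leibnizTerm, Nat.choose_self, Nat.cast_one, one_mul, Nat.sub_self, iteratedDeriv_zero,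
      norm_mul, norm_mul, Real.norm_eq_abs, Real.norm_eq_abs, Real.norm_eq_abs]
    have h2 : |H x - H (x - h)| ≤ 1 := by
      rw [abs_le]
      constructor <;> linarith [hu.nonneg x, hu.le_one x, hu.nonneg (x - h), hu.le_one (x - h)]
    have h3 : |x ^ (n - k)| ≤ 2 * h := by
      rw [abs_of_nonneg (pow_nonneg hx.1 _)]
      exact (pow_le_of_le_one hx.1 (hx.2.trans hh2) (by lia)).trans hx.2
    have h4 : |(n.descFactorial k : ℝ) / n.factorial| ≤ 1 := by
      rw [abs_of_nonneg (by positivity)]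
      exact descFactorial_div_factorial_le_one n k
    calc _ ≤ 1 * (2 * h) * 1 := by gcongr
      _ = 2 * h := by ring
  · rw [hz x hx, norm_zero]
    linarith

/-- A smooth function whose `n`-th derivative is close to the indicator function of `[0, h)` and
whose other derivatives are small in `L^p`. -/
theorem IsPRegular.exists_bump (hM : IsPRegular p M) (hp0 : 0 < p) (hp1 : p < 1) (n : ℕ)
    {h ε : ℝ} (hh : 0 < h) (hh2 : 2 * h ≤ 1) (hε : 0 < ε) :
    ∃ v : ℝ → ℝ, HasSlowDerivs v ∧ ∀ k, powIntegral p (fun x => iteratedDeriv k v x -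
        if k = n then (Ico 0 h).indicator (fun _ => (1 : ℝ)) x else 0) ≤
      ENNReal.ofReal ((if k < n then (2 * h) ^ p * (2 * h) else 0) + ε * M k ^ p) := by
  obtain ⟨c, hc1, hc⟩ := hM.exists_choose_mul_le hp0 hp1
  have hMn : 0 < M n ^ p := Real.rpow_pos_of_pos (hM.pos n) p
  set B := 2 * (c ^ n) ^ p * (n + 1) with hB
  have hB0 : 0 < B := by positivity
  -- Three demands: a transition no wider than `h`, a plateau error of at most `(ε/2) M_n^p`, and a
  -- total of at most `(ε/2) M_k^p` for the differentiated terms.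
  set δ := min h (min (ε * M n ^ p / 4) (ε / (2 * B))) with hδ
  have hδ0 : 0 < δ := by positivity
  have hδ1 : δ ≤ h := min_le_left _ _
  have hδ2 : 2 * δ ≤ ε / 2 * M n ^ p := by
    have : δ ≤ ε * M n ^ p / 4 := (min_le_right _ _).trans (min_le_left _ _)
    linarith
  have hδ3 : δ * B ≤ ε / 2 := by
    have : δ ≤ ε / (2 * B) := (min_le_right _ _).trans (min_le_right _ _)
    rw [le_div_iff₀ (by positivity)] at this
    linarith
  obtain ⟨H, hH, hu, h0, h1, hHδ, hA⟩ := hM.exists_smoothStep hp0 hp1 hδ0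
  have hr : h + δ ≤ 1 := by linarith
  refine ⟨monomialBump H h n, hasSlowDerivs_monomialBump ⟨hH, hA⟩ h0 h1 hh.le hr n, fun k => ?_⟩
  have hMk : 0 < M k ^ p := Real.rpow_pos_of_pos (hM.pos k) p
  set t : ℝ → ℝ := fun x => leibnizTerm H h n k k x -
    if k = n then (Ico 0 h).indicator (fun _ => (1 : ℝ)) x else 0 with ht
  have hsplit : (fun x => iteratedDeriv k (monomialBump H h n) x -
      if k = n then (Ico 0 h).indicator (fun _ => (1 : ℝ)) x else 0) =
      fun x => ∑ i ∈ Finset.range k, leibnizTerm H h n k i x + t x := by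
    ext x
    rw [iteratedDeriv_monomialBump hH, Finset.sum_range_succ, ht]
    ring
  have hcont := fun i => continuous_leibnizTerm hH h n k i
  have h2 : powIntegral p (fun x => ∑ i ∈ Finset.range k, leibnizTerm H h n k i x) ≤
      ENNReal.ofReal (ε / 2 * M k ^ p) := by
    refine (powIntegral_sum_le hp0 hp1.le _ fun i _ => (hcont i).aestronglyMeasurable).trans ?_
    -- Only `i ≤ n` survive, since the monomial has degree `n`; the number of terms is thus at most
    -- `n + 1` whatever `k` is.
    have h3 : ∀ i ∈ Finset.range k, powIntegral p (leibnizTerm H h n k i) ≤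
        if i ∈ Finset.range (n + 1) then
          ENNReal.ofReal (2 * δ * (c ^ n) ^ p * M k ^ p) else 0 := by
      intro i hi
      split_ifs with hin
      · exact powIntegral_leibnizTerm_le hp0 hp1 hM.pos hc1 hc hH h0 h1 hh.le hr hδ0 hHδ
          (Nat.lt_succ_iff.1 (Finset.mem_range.1 hin)) (Finset.mem_range.1 hi)
      · have hin' : n < i := by rw [Finset.mem_range] at hin; lia
        simp [powIntegral, leibnizTerm_eq_zero hin', hp0]
    refine (Finset.sum_le_sum h3).trans ?_
    rw [← Finset.sum_filter, Finset.sum_const, nsmul_eq_mul]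
    have h4 : (((Finset.range k).filter (· ∈ Finset.range (n + 1))).card : ℝ≥0∞) ≤
        ENNReal.ofReal (n + 1) := by
      rw [← ENNReal.ofReal_natCast]
      refine ENNReal.ofReal_le_ofReal ?_
      have : ((Finset.range k).filter (· ∈ Finset.range (n + 1))).card ≤ n + 1 := by
        refine (Finset.card_le_card fun i hi => ?_).trans_eq (Finset.card_range (n + 1))
        exact (Finset.mem_filter.1 hi).2
      exact_mod_cast this
    refine (mul_le_mul_left h4 _).trans ?_
    rw [← ENNReal.ofReal_mul (by positivity)]
    refine ENNReal.ofReal_le_ofReal ?_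
    have : δ * B * M k ^ p ≤ ε / 2 * M k ^ p := mul_le_mul_of_nonneg_right hδ3 hMk.le
    refine le_trans (le_of_eq ?_) this
    rw [hB]
    ring
  have h3 : powIntegral p t ≤
      ENNReal.ofReal ((if k < n then (2 * h) ^ p * (2 * h) else 0) + ε / 2 * M k ^ p) := by
    rcases lt_trichotomy k n with hk | hk | hk
    · simp only [ht, hk.ne, if_false, sub_zero, hk, if_true]
      refine (powIntegral_leibnizTerm_self_le hp0 hu h0 h1 hh hh2 hδ1 hk).trans
        (ENNReal.ofReal_le_ofReal ?_)
      have : 0 ≤ ε / 2 * M k ^ p := by positivity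
      linarith
    · subst hk
      have h5 : t = fun x => H x - H (x - h) - (Ico 0 h).indicator (fun _ => (1 : ℝ)) x := by
        ext x
        simp [ht, leibnizTerm, Nat.descFactorial_self, Nat.factorial_ne_zero]
      rw [h5]
      refine (powIntegral_plateau_sub_indicator_le hp0 hp1.le hH.continuous hu h0 h1 hh.le).trans
        (ENNReal.ofReal_le_ofReal ?_)
      simpa using hδ2
    · have h5 : t = fun _ => 0 := by
        ext x
        simp [ht, leibnizTerm_eq_zero hk, hk.ne']
      rw [h5]
      simp [powIntegral, hp0]
  rw [hsplit]
  refine (powIntegral_add_le hp0.le hp1.le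
    (continuous_finsetSum _ fun i _ => hcont i).aestronglyMeasurable _).trans
    ((add_le_add h2 h3).trans_eq ?_)
  rw [← ENNReal.ofReal_add (by positivity) (by split_ifs <;> positivity)]
  congr 1
  ring

end Approximation

/-! ### Stability of slow derivative growth -/

section SlowDerivs

variable {E : Type*} [NormedAddCommGroup E] [NormedSpace ℝ E]

theorem HasSlowDerivs.zero : HasSlowDerivs fun _ : ℝ => (0 : E) :=
  ⟨contDiff_const, 0, fun k x => by
    rw [show iteratedDeriv k (fun _ : ℝ => (0 : E)) x = 0 by simp]; simp⟩

theorem iteratedDeriv_add_of_smooth {f g : ℝ → E} (hf : ContDiff ℝ (⊤ : ℕ∞) f)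
    (hg : ContDiff ℝ (⊤ : ℕ∞) g) (k : ℕ) (x : ℝ) :
    iteratedDeriv k (fun x => f x + g x) x = iteratedDeriv k f x + iteratedDeriv k g x :=
  iteratedDeriv_fun_add (hf.contDiffAt.of_le (mod_cast le_top))
    (hg.contDiffAt.of_le (mod_cast le_top))

theorem HasSlowDerivs.add {f g : ℝ → E} (hf : HasSlowDerivs f) (hg : HasSlowDerivs g) :
    HasSlowDerivs fun x => f x + g x := by
  obtain ⟨hf, A, hA⟩ := hf
  obtain ⟨hg, B, hB⟩ := hg
  refine ⟨hf.add hg, max A B + Real.log 2, fun k x => ?_⟩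
  rw [iteratedDeriv_add_of_smooth hf hg]
  have hk : (1 : ℝ) ≤ ((k : ℝ) + 1) ^ 2 := by nlinarith [k.cast_nonneg (α := ℝ)]
  have hk0 : (0 : ℝ) ≤ ((k : ℝ) + 1) ^ 2 := by positivity
  have h1 : Real.exp (A * (k + 1) ^ 2) ≤ Real.exp (max A B * (k + 1) ^ 2) :=
    Real.exp_le_exp.2 (mul_le_mul_of_nonneg_right (le_max_left _ _) hk0)
  have h2 : Real.exp (B * (k + 1) ^ 2) ≤ Real.exp (max A B * (k + 1) ^ 2) :=
    Real.exp_le_exp.2 (mul_le_mul_of_nonneg_right (le_max_right _ _) hk0)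
  calc _ ≤ 2 * Real.exp (max A B * (k + 1) ^ 2) := by
        rw [two_mul]
        exact (norm_add_le _ _).trans (add_le_add ((hA k x).trans h1) ((hB k x).trans h2))
    _ = Real.exp (Real.log 2 + max A B * (k + 1) ^ 2) := by rw [Real.exp_add, Real.exp_log two_pos]
    _ ≤ _ := by
        rw [Real.exp_le_exp]
        nlinarith [Real.log_nonneg one_le_two]

theorem HasSlowDerivs.sum {ι : Type*} (s : Finset ι) {f : ι → ℝ → E}
    (hf : ∀ i ∈ s, HasSlowDerivs (f i)) : HasSlowDerivs fun x => ∑ i ∈ s, f i x := by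
  classical
  induction s using Finset.induction_on with
  | empty => simpa using HasSlowDerivs.zero
  | insert i s hi ih =>
    simp only [Finset.sum_insert hi]
    exact (hf i (Finset.mem_insert_self _ _)).add
      (ih fun j hj => hf j (Finset.mem_insert_of_mem hj))

theorem iteratedDeriv_comp_sub_smul_const {v : ℝ → ℝ} (hv : ContDiff ℝ (⊤ : ℕ∞) v) (s : ℝ) (c : E)
    (k : ℕ) (x : ℝ) :
    iteratedDeriv k (fun x => v (x - s) • c) x = iteratedDeriv k v (x - s) • c := by
  have h : ContDiff ℝ k fun x => v (x - s) :=
    (hv.comp (contDiff_id.sub contDiff_const)).of_le (mod_cast le_top)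
  have h1 := iteratedDeriv_smul_const h.contDiffAt (x := x) c
  rw [iteratedDeriv_comp_sub_const] at h1
  exact h1

theorem HasSlowDerivs.comp_sub_smul_const {v : ℝ → ℝ} (hv : HasSlowDerivs v) (s : ℝ) (c : E) :
    HasSlowDerivs fun x => v (x - s) • c := by
  obtain ⟨hv, A, hA⟩ := hv
  refine ⟨(hv.comp (contDiff_id.sub contDiff_const)).smul contDiff_const, A + ‖c‖, fun k x => ?_⟩
  rw [iteratedDeriv_comp_sub_smul_const hv, norm_smul, add_mul, Real.exp_add]
  refine mul_le_mul (hA k _) ?_ (norm_nonneg _) (Real.exp_pos _).le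
  have hk : (1 : ℝ) ≤ ((k : ℝ) + 1) ^ 2 := by nlinarith [k.cast_nonneg (α := ℝ)]
  have h1 : ‖c‖ ≤ ‖c‖ * (k + 1) ^ 2 := le_mul_of_one_le_right (norm_nonneg c) hk
  linarith [Real.add_one_le_exp (‖c‖ * ((k : ℝ) + 1) ^ 2)]

end SlowDerivs

/-! ### Approximation of sequences by the derivatives of one function -/

section StepFunctions

variable {E : Type*} [NormedAddCommGroup E] [NormedSpace ℝ E]

theorem indicator_Ico_sub_grid {R L : ℝ} (hL : 0 < L) {x : ℝ} (hx : -R ≤ x) (s : ℕ) :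
    (Ico 0 L⁻¹).indicator (fun _ => (1 : ℝ)) (x - (-R + s / L)) =
      if s = ⌊(x + R) * L⌋₊ then 1 else 0 := by
  have h0 : 0 ≤ (x + R) * L := mul_nonneg (by linarith) hL.le
  have h : x - (-R + s / L) ∈ Ico 0 L⁻¹ ↔ s = ⌊(x + R) * L⌋₊ := by
    rw [eq_comm, Nat.floor_eq_iff h0, mem_Ico]
    have e : x - (-R + s / L) = ((x + R) * L - s) / L := by
      field_simp
      ring
    rw [e, inv_eq_one_div, div_lt_div_iff_of_pos_right hL]
    refine and_congr ?_ ⟨fun h => by linarith, fun h => by linarith⟩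
    rw [le_div_iff₀ hL, zero_mul, sub_nonneg]
  rw [indicator_apply]
  simp only [h]

theorem sum_indicator_grid (R N : ℕ) (hN : 0 < N) (f : ℝ → E) (x : ℝ) :
    ∑ s ∈ Finset.range (2 * R * N), (Ico 0 (N : ℝ)⁻¹).indicator (fun _ => (1 : ℝ))
        (x - (-R + s / N)) • f (-R + s / N) =
      if x ∈ Ico (-R : ℝ) R then f (-R + ⌊(x + R) * N⌋₊ / N) else 0 := by
  have hN' : (0 : ℝ) < N := by exact_mod_cast hN
  rcases lt_or_ge x (-R : ℝ) with hx | hx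
  · rw [if_neg fun h => (not_le.2 hx) h.1]
    refine Finset.sum_eq_zero fun s _ => ?_
    rw [indicator_of_notMem, zero_smul]
    intro h
    have : (0 : ℝ) ≤ s / N := by positivity
    linarith [h.1]
  · simp only [indicator_Ico_sub_grid hN' hx, ite_smul, one_smul, zero_smul, Finset.sum_ite_eq',
      Finset.mem_range, mem_Ico, hx, true_and]
    refine if_congr ?_ rfl rfl
    rw [Nat.floor_lt (mul_nonneg (by linarith) hN'.le)]
    push_cast
    rw [mul_lt_mul_iff_left₀ hN']
    constructor <;> intro h <;> linarith

/-- Uniform continuity gives the first estimate. In the second, `O(1/h)` pieces each cost a multiple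
of `h^(p+1)`, so the total is `O(h^p)`. -/
theorem exists_step_approx {p : ℝ} (hp0 : 0 < p) {f : ℝ → E} (hf : Continuous f)
    (hfc : HasCompactSupport f) {μ : ℝ} (hμ : 0 < μ) :
    ∃ (h : ℝ) (N : ℕ) (t : ℕ → ℝ), 0 < h ∧ 2 * h ≤ 1 ∧
      powIntegral p (fun x => ∑ s ∈ Finset.range N,
        (Ico 0 h).indicator (fun _ => (1 : ℝ)) (x - t s) • f (t s) - f x) ≤ ENNReal.ofReal μ ∧
      (∑ s ∈ Finset.range N, ‖f (t s)‖ ^ p) * ((2 * h) ^ p * (2 * h)) ≤ μ := by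
  obtain ⟨F, hF⟩ := hf.bounded_above_of_compact_support hfc
  have hF0 : 0 ≤ F := (norm_nonneg _).trans (hF 0)
  obtain ⟨R₀, hR₀⟩ := hfc.isCompact.isBounded.subset_closedBall 0
  obtain ⟨R, hR⟩ := exists_nat_gt (max R₀ 0)
  have hR0 : (0 : ℝ) < R := (le_max_right _ _).trans_lt hR
  have hfR : ∀ x : ℝ, (R : ℝ) ≤ |x| → f x = 0 := by
    intro x hx
    refine image_eq_zero_of_notMem_tsupport fun hx' => ?_
    have h1 : |x| ≤ R₀ := by simpa using hR₀ hx'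
    linarith [le_max_left R₀ 0]
  -- Chosen so that `δ^p` times the length `2R` equals `μ`.
  set δ := (μ / (2 * R)) ^ p⁻¹ with hδ
  have hδ0 : 0 < δ := by positivity
  obtain ⟨η, hη, hfη⟩ := Metric.uniformContinuous_iff.1
    (hf.uniformContinuous_of_tendsto_cocompact hfc.is_zero_at_infty) δ hδ0
  -- The bound for `2RN` pieces of width `h = 1/N` and values of norm at most `F`.
  have hlim : Tendsto (fun N : ℕ => 4 * R * F ^ p * (2 * (N : ℝ)⁻¹) ^ p) atTop (𝓝 0) := by
    have h1 := (tendsto_inv_atTop_nhds_zero_nat (𝕜 := ℝ)).const_mul 2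
    rw [mul_zero] at h1
    have h2 := (h1.rpow_const (p := p) (Or.inr hp0.le)).const_mul (4 * R * F ^ p)
    rwa [Real.zero_rpow hp0.ne', mul_zero] at h2
  obtain ⟨N, hN1, hN2, hN3⟩ := ((hlim.eventually_lt_const hμ).and
    (((tendsto_inv_atTop_nhds_zero_nat (𝕜 := ℝ)).eventually_lt_const hη).and
      (eventually_ge_atTop 2))).exists
  have hN0 : (0 : ℝ) < N := by exact_mod_cast (by lia : 0 < N)
  have hN3' : (2 : ℝ) ≤ N := by exact_mod_cast hN3
  refine ⟨(N : ℝ)⁻¹, 2 * R * N, fun s => -R + s / N, inv_pos.2 hN0, ?_, ?_, ?_⟩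
  · rw [← div_eq_mul_inv, div_le_one hN0]
    exact hN3'
  · have hz : ∀ x ∉ Ico (-R : ℝ) R, ∑ s ∈ Finset.range (2 * R * N),
        (Ico 0 (N : ℝ)⁻¹).indicator (fun _ => (1 : ℝ)) (x - (-R + s / N)) • f (-R + s / N)
          - f x = 0 := by
      intro x hx
      rw [sum_indicator_grid R N (by lia), if_neg hx, hfR x, sub_zero]
      by_contra! h
      rw [abs_lt] at h
      exact hx ⟨h.1.le, h.2⟩
    refine (powIntegral_le_of_bound (C := δ) (a := -R) (b := R) hp0 (fun x => ?_)
      fun x hx => hz x fun hx' => hx (Ico_subset_Icc_self hx')).trans_eq ?_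
    · by_cases hx : x ∈ Ico (-R : ℝ) R
      · rw [sum_indicator_grid R N (by lia), if_pos hx, ← dist_eq_norm]
        refine (hfη ?_).le
        have h0 : 0 ≤ (x + R) * N := mul_nonneg (by linarith [hx.1]) hN0.le
        have h1 := Nat.floor_le h0
        have h2 := Nat.lt_floor_add_one ((x + R) * N)
        refine lt_of_le_of_lt ?_ hN2
        rw [Real.dist_eq, show -(R : ℝ) + ⌊(x + R) * N⌋₊ / N - x =
          (⌊(x + R) * N⌋₊ - (x + R) * N) / N by field_simp; ring, abs_div, abs_of_pos hN0,
          inv_eq_one_div]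
        refine div_le_div_of_nonneg_right ?_ hN0.le
        rw [abs_le]
        constructor <;> linarith
      · rw [hz x hx, norm_zero]
        exact hδ0.le
    · rw [hδ, ← Real.rpow_mul (by positivity), inv_mul_cancel₀ hp0.ne', Real.rpow_one]
      congr 1
      field_simp
      ring
  · have h1 : ∑ s ∈ Finset.range (2 * R * N), ‖f (-R + s / N)‖ ^ p ≤ 2 * R * N * F ^ p := by
      refine (Finset.sum_le_card_nsmul _ _ (F ^ p) fun s _ =>
        Real.rpow_le_rpow (norm_nonneg _) (hF _) hp0.le).trans_eq ?_
      simp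
    refine (mul_le_mul_of_nonneg_right h1 (by positivity)).trans (le_trans (le_of_eq ?_) hN1.le)
    field_simp
    ring

end StepFunctions

/-! ### From compactly supported functions to finite sequences in `L^p` -/

section Approximation

variable {𝕜 : Type*} [RCLike 𝕜] {p : ℝ} {M : ℕ → ℝ}

theorem IsPRegular.exists_approx_of_hasCompactSupport (hM : IsPRegular p M) (hp0 : 0 < p)
    (hp1 : p < 1) (n : ℕ) {f : ℝ → 𝕜} (hf : Continuous f) (hfc : HasCompactSupport f)
    {ε : ℝ} (hε : 0 < ε) :
    ∃ g : ℝ → 𝕜, HasSlowDerivs g ∧ ∀ k, powIntegral p (fun x => iteratedDeriv k g x -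
      if k = n then f x else 0) ≤ ENNReal.ofReal (ε * M k ^ p) := by
  have hMp : ∀ k, 0 < M k ^ p := fun k => Real.rpow_pos_of_pos (hM.pos k) p
  obtain ⟨k₀, -, hk₀⟩ := Finset.exists_min_image (Finset.range (n + 1)) (fun k => M k ^ p)
    ⟨0, by simp⟩
  -- The errors that depend on the step size occur only in orders `k ≤ n`, so the least of these
  -- finitely many weights controls them all.
  set μ := ε / 2 * M k₀ ^ p with hμ
  have hμ0 : 0 < μ := mul_pos (by linarith) (hMp k₀)
  have hμk : ∀ k ≤ n, μ ≤ ε / 2 * M k ^ p := fun k hk =>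
    mul_le_mul_of_nonneg_left (hk₀ k (Finset.mem_range.2 (by lia))) (by linarith)
  obtain ⟨h, N, t, hh, hh2, hstep, hsum⟩ := exists_step_approx hp0 hf hfc hμ0
  set W := ∑ s ∈ Finset.range N, ‖f (t s)‖ ^ p with hW
  have hW0 : 0 ≤ W := Finset.sum_nonneg fun s _ => Real.rpow_nonneg (norm_nonneg _) p
  -- The grid and hence `W` are fixed before the bump, whose error in each order is multiplied by
  -- `W`.
  set ε' := ε / (2 * (W + 1)) with hε'
  have hε'0 : 0 < ε' := by positivity
  have hWε : W * ε' ≤ ε / 2 := by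
    rw [hε', ← mul_div_assoc, div_le_div_iff₀ (by positivity) two_pos]
    nlinarith
  obtain ⟨v, hv, hvk⟩ := hM.exists_bump hp0 hp1 n hh hh2 hε'0
  refine ⟨fun x => ∑ s ∈ Finset.range N, v (x - t s) • f (t s),
    HasSlowDerivs.sum _ fun s _ => hv.comp_sub_smul_const _ _, fun k => ?_⟩
  set e : ℝ → ℝ := fun x => iteratedDeriv k v x -
    if k = n then (Ico 0 h).indicator (fun _ => (1 : ℝ)) x else 0 with he
  have hem : Measurable e := by
    refine (continuous_iteratedDeriv_of_smooth hv.1 k).measurable.sub ?_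
    split_ifs
    · exact measurable_const.indicator measurableSet_Ico
    · exact measurable_const
  have hsm : ∀ s, AEStronglyMeasurable (fun x => e (x - t s) • f (t s)) volume := fun s =>
    ((hem.comp (measurable_id.sub_const _)).smul_const _).aestronglyMeasurable
  have hsplit : (fun x => iteratedDeriv k (fun x => ∑ s ∈ Finset.range N, v (x - t s) • f (t s)) x -
      if k = n then f x else 0) = fun x => ∑ s ∈ Finset.range N, e (x - t s) • f (t s) +
        if k = n then ∑ s ∈ Finset.range N,
          (Ico 0 h).indicator (fun _ => (1 : ℝ)) (x - t s) • f (t s) - f x else 0 := by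
    ext x
    rw [iteratedDeriv_fun_sum fun s _ =>
      ((hv.comp_sub_smul_const (t s) (f (t s))).1.of_le (mod_cast le_top)).contDiffAt]
    simp only [iteratedDeriv_comp_sub_smul_const hv.1, he, sub_smul, Finset.sum_sub_distrib]
    split_ifs
    · abel
    · simp
  have h1 : powIntegral p (fun x => ∑ s ∈ Finset.range N, e (x - t s) • f (t s)) ≤
      ENNReal.ofReal (W * ((if k < n then (2 * h) ^ p * (2 * h) else 0) + ε' * M k ^ p)) := by
    refine (powIntegral_sum_le hp0 hp1.le _ fun s _ => hsm s).trans ?_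
    have h2 : ∀ s, powIntegral p (fun x => e (x - t s) • f (t s)) =
        ENNReal.ofReal (‖f (t s)‖ ^ p) * powIntegral p e := by
      intro s
      have h3 := powIntegral_smul hp0.le ‖f (t s)‖ fun x => e (x - t s)
      rw [powIntegral_comp_sub, norm_norm] at h3
      rw [← h3]
      unfold powIntegral
      refine lintegral_congr fun x => ?_
      rw [enorm_smul, enorm_smul, enorm_norm, mul_comm]
    simp only [h2]
    rw [← Finset.sum_mul, ← ENNReal.ofReal_sum_of_nonneg fun s _ =>
      Real.rpow_nonneg (norm_nonneg _) p, ← hW, ENNReal.ofReal_mul hW0]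
    exact mul_le_mul_right (hvk k) _
  rw [hsplit]
  refine (powIntegral_add_le hp0.le hp1.le
    (Finset.aestronglyMeasurable_fun_sum _ fun s _ => hsm s) _).trans ?_
  have hk2 : W * (ε' * M k ^ p) ≤ ε / 2 * M k ^ p := by
    rw [← mul_assoc]
    exact mul_le_mul_of_nonneg_right hWε (hMp k).le
  rcases lt_trichotomy k n with hk | hk | hk
  · simp only [hk.ne, if_false]
    rw [if_pos hk] at h1
    have h0 : powIntegral p (fun _ : ℝ => (0 : 𝕜)) = 0 := by simp [powIntegral, hp0]
    rw [h0, add_zero]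
    refine h1.trans (ENNReal.ofReal_le_ofReal ?_)
    have := hμk k hk.le
    linarith
  · simp only [hk, if_true]
    rw [hk, if_neg (lt_irrefl n), zero_add] at h1
    rw [hk] at hk2
    refine (add_le_add h1 hstep).trans ?_
    rw [← ENNReal.ofReal_add (mul_nonneg hW0 (mul_pos hε'0 (hMp n)).le) hμ0.le]
    refine ENNReal.ofReal_le_ofReal ?_
    have := hμk n le_rfl
    linarith
  · simp only [hk.ne', if_false]
    rw [if_neg hk.not_gt, zero_add] at h1
    have h0 : powIntegral p (fun _ : ℝ => (0 : 𝕜)) = 0 := by simp [powIntegral, hp0]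
    rw [h0, add_zero]
    refine h1.trans (ENNReal.ofReal_le_ofReal ?_)
    nlinarith [hMp k]

theorem eLpNorm_rpow_eq_powIntegral {E : Type*} [NormedAddCommGroup E] (hp0 : 0 < p) (f : ℝ → E) :
    eLpNorm f (ENNReal.ofReal p) volume ^ p = powIntegral p f := by
  rw [eLpNorm_eq_lintegral_rpow_enorm_toReal (by simpa using hp0) ENNReal.ofReal_ne_top,
    ENNReal.toReal_ofReal hp0.le, ← ENNReal.rpow_mul, one_div, inv_mul_cancel₀ hp0.ne',
    ENNReal.rpow_one]
  rfl

theorem eLpNorm_le_ofReal_iff {E : Type*} [NormedAddCommGroup E] (hp0 : 0 < p) (f : ℝ → E)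
    {C : ℝ} (hC : 0 ≤ C) : eLpNorm f (ENNReal.ofReal p) volume ≤ ENNReal.ofReal C ↔
      powIntegral p f ≤ ENNReal.ofReal (C ^ p) := by
  rw [← eLpNorm_rpow_eq_powIntegral hp0, ← ENNReal.ofReal_rpow_of_nonneg hC hp0.le,
    ENNReal.rpow_le_rpow_iff hp0]

theorem IsPRegular.exists_approx_single (hM : IsPRegular p M) (hp0 : 0 < p)
    (hp1 : p < 1) (n : ℕ) {f : ℝ → 𝕜} (hf : MemLp f (ENNReal.ofReal p) volume)
    {ε : ℝ} (hε : 0 < ε) :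
    ∃ g : ℝ → 𝕜, HasSlowDerivs g ∧ ∀ k, powIntegral p (fun x => iteratedDeriv k g x -
      if k = n then f x else 0) ≤ ENNReal.ofReal (ε * M k ^ p) := by
  have hMp : ∀ k, 0 < M k ^ p := fun k => Real.rpow_pos_of_pos (hM.pos k) p
  have hη : 0 < ε / 2 * M n ^ p := mul_pos (by linarith) (hMp n)
  obtain ⟨φ, hφc, hφ, hφcont, -⟩ := hf.exists_hasCompactSupport_eLpNorm_sub_le
    (ε := ENNReal.ofReal ((ε / 2 * M n ^ p) ^ p⁻¹)) ENNReal.ofReal_ne_top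
    (ENNReal.ofReal_pos.2 (Real.rpow_pos_of_pos hη _)).ne'
  rw [eLpNorm_sub_comm, eLpNorm_le_ofReal_iff hp0 _ (Real.rpow_nonneg hη.le _),
    ← Real.rpow_mul hη.le, inv_mul_cancel₀ hp0.ne', Real.rpow_one] at hφ
  obtain ⟨g, hg, hgk⟩ := hM.exists_approx_of_hasCompactSupport hp0 hp1 n hφcont hφc (half_pos hε)
  refine ⟨g, hg, fun k => ?_⟩
  by_cases hk : k = n
  · subst hk
    have h1 := hgk k
    simp only [if_true] at h1 ⊢
    have h2 : (fun x => iteratedDeriv k g x - f x) =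
        fun x => (iteratedDeriv k g x - φ x) + (φ - f) x := by
      ext x
      simp
    rw [h2]
    refine (powIntegral_add_le hp0.le hp1.le ((continuous_iteratedDeriv_of_smooth hg.1 k).sub
      hφcont).aestronglyMeasurable _).trans ((add_le_add h1 hφ).trans_eq ?_)
    rw [← ENNReal.ofReal_add hη.le hη.le]
    congr 1
    ring
  · have h1 := hgk k
    simp only [hk, if_false] at h1 ⊢
    refine h1.trans (ENNReal.ofReal_le_ofReal ?_)
    nlinarith [hMp k]

theorem IsPRegular.exists_approx_finite (hM : IsPRegular p M) (hp0 : 0 < p)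
    (hp1 : p < 1) (N : ℕ) {f : ℕ → ℝ → 𝕜} (hf : ∀ n, MemLp (f n) (ENNReal.ofReal p) volume)
    {ε : ℝ} (hε : 0 < ε) :
    ∃ g : ℝ → 𝕜, HasSlowDerivs g ∧ ∀ k, powIntegral p (fun x => iteratedDeriv k g x -
      if k < N then f k x else 0) ≤ ENNReal.ofReal (ε * M k ^ p) := by
  induction N generalizing ε with
  | zero =>
    refine ⟨fun _ => 0, HasSlowDerivs.zero, fun k => ?_⟩
    have : ∀ x, iteratedDeriv k (fun _ : ℝ => (0 : 𝕜)) x = 0 := fun x => by simp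
    simp [powIntegral, this, hp0]
  | succ N ih =>
    obtain ⟨g₁, hg₁, h₁⟩ := ih (half_pos hε)
    obtain ⟨g₂, hg₂, h₂⟩ := hM.exists_approx_single hp0 hp1 N (hf N) (half_pos hε)
    refine ⟨fun x => g₁ x + g₂ x, hg₁.add hg₂, fun k => ?_⟩
    have h3 : (fun x => iteratedDeriv k (fun x => g₁ x + g₂ x) x -
        if k < N + 1 then f k x else 0) =
        fun x => (iteratedDeriv k g₁ x - if k < N then f k x else 0) +
          (iteratedDeriv k g₂ x - if k = N then f N x else 0) := by
      ext x
      rw [iteratedDeriv_add_of_smooth hg₁.1 hg₂.1]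
      rcases lt_trichotomy k N with hk | rfl | hk
      · simp only [hk, hk.ne, Nat.lt_succ_of_lt hk, if_true, if_false]
        ring
      · simp only [lt_irrefl, Nat.lt_succ_self, if_true, if_false]
        ring
      · simp only [hk.not_gt, hk.ne', if_false, show ¬ k < N + 1 by lia]
        ring
    have hm : AEStronglyMeasurable
        (fun x => iteratedDeriv k g₁ x - if k < N then f k x else 0) volume := by
      refine (continuous_iteratedDeriv_of_smooth hg₁.1 k).aestronglyMeasurable.sub ?_
      split_ifs
      · exact (hf k).1
      · exact aestronglyMeasurable_const
    rw [h3]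
    have hMp : 0 < M k ^ p := Real.rpow_pos_of_pos (hM.pos k) p
    refine (powIntegral_add_le hp0.le hp1.le hm _).trans ((add_le_add (h₁ k) (h₂ k)).trans_eq ?_)
    rw [← ENNReal.ofReal_add (by positivity) (by positivity)]
    congr 1
    ring

end Approximation

/-! ### The image of the canonical map -/

section Image

variable {𝕜 : Type*} [RCLike 𝕜] {p θ : ℝ} {M : ℕ → ℝ}

/-- The logarithm of the sup norm is at most quadratic in `n`, which `(1-p)^n` sends to 0. -/
theorem HasSlowDerivs.limsup_le {g : ℝ → 𝕜} (hg : HasSlowDerivs g) (hp0 : 0 < p) (hp1 : p < 1)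
    (hθ : 0 ≤ θ) :
    limsup (fun n : ℕ => (((1 - p) ^ n : ℝ) : EReal) *
      ENNReal.log (eLpNorm (iteratedDeriv n g) ∞ volume)) atTop ≤ (θ : EReal) := by
  obtain ⟨-, A, hA⟩ := hg
  have hq0 : 0 < 1 - p := by linarith
  have h1 : ∀ n : ℕ, (((1 - p) ^ n : ℝ) : EReal) *
      ENNReal.log (eLpNorm (iteratedDeriv n g) ∞ volume) ≤
      (((1 - p) ^ n * (A * (n + 1) ^ 2) : ℝ) : EReal) := by
    intro n
    rw [EReal.coe_mul]
    refine mul_le_mul_of_nonneg_left ?_ (by exact_mod_cast (pow_pos hq0 n).le)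
    rw [eLpNorm_exponent_top]
    refine (ENNReal.log_le_log
      (eLpNormEssSup_le_of_ae_bound (Eventually.of_forall fun x => hA n x))).trans_eq ?_
    rw [ENNReal.log_ofReal, if_neg (not_le.2 (Real.exp_pos _)), Real.log_exp]
  have h2 : Tendsto (fun n : ℕ => (1 - p) ^ n * (A * ((n : ℝ) + 1) ^ 2)) atTop (𝓝 0) := by
    have hlt : |1 - p| < 1 := by rw [abs_of_pos hq0]; linarith
    have h3 := (tendsto_add_atTop_iff_nat 1).2
      (tendsto_pow_const_mul_const_pow_of_abs_lt_one 2 hlt)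
    have h4 := h3.const_mul (A / (1 - p))
    rw [mul_zero] at h4
    refine h4.congr fun n => ?_
    push_cast
    rw [pow_succ (1 - p) n]
    field_simp
  have h5 : Tendsto (fun n : ℕ => (((1 - p) ^ n * (A * ((n : ℝ) + 1) ^ 2) : ℝ) : EReal)) atTop
      (𝓝 ((0 : ℝ) : EReal)) := (continuous_coe_real_ereal.tendsto 0).comp h2
  refine (limsup_le_limsup (Eventually.of_forall h1)).trans ?_
  rw [h5.limsup_eq]
  exact_mod_cast hθ

theorem iSup_lt_top_of_tendsto_zero {u : ℕ → ℝ≥0∞} (hu : ∀ n, u n < ∞)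
    (h : Tendsto u atTop (𝓝 0)) : ⨆ n, u n < ∞ := by
  obtain ⟨N, hN⟩ := eventually_atTop.1 (h.eventually_lt_const one_pos)
  refine lt_of_le_of_lt (iSup_le fun n => ?_) (b := 1 + ∑ k ∈ Finset.range N, u k)
    (ENNReal.add_lt_top.2 ⟨ENNReal.one_lt_top, ENNReal.sum_lt_top.2 fun k _ => hu k⟩)
  rcases lt_or_ge n N with hn | hn
  · exact (Finset.single_le_sum (f := u) (fun _ _ => zero_le) (Finset.mem_range.2 hn)).trans
      le_add_self
  · exact (hN n hn).le.trans le_self_add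

theorem eLpNorm_le_of_sub {f g : ℝ → 𝕜} {q : ℝ≥0∞} (hf : AEStronglyMeasurable f volume)
    (hg : AEStronglyMeasurable g volume) :
    eLpNorm f q volume ≤ ENNReal.LpAddConst q * (eLpNorm (f - g) q volume + eLpNorm g q volume) := by
  simpa using eLpNorm_add_le' (hf.sub hg) hg q

theorem LpSpace.qnorm_lt_top (f : LpSpace 𝕜 p) : f.qnorm < ∞ := Lp.eLpNorm_lt_top f.toLp

/-- Beyond `N` the derivatives of `g` approximate 0 and `f_k` is itself small; each error takes half
of `ε^p`. -/
theorem IsPRegular.exists_test (hM : IsPRegular p M) (hp0 : 0 < p) (hp1 : p < 1) (hθ : 0 ≤ θ)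
    {f : ℕ → LpSpace 𝕜 p}
    (hf : Tendsto (fun n => (f n).qnorm / ENNReal.ofReal (M n)) atTop (𝓝 0)) {ε : ℝ}
    (hε : 0 < ε) :
    ∃ g : CarlemanTest 𝕜 p θ M, ∀ k,
      eLpNorm (iteratedDeriv k g.1 - ⇑(f k).toLp) (ENNReal.ofReal p) volume ≤
        ENNReal.ofReal ε * ENNReal.ofReal (M k) := by
  have hMpos : ∀ k, 0 < ENNReal.ofReal (M k) := fun k => ENNReal.ofReal_pos.2 (hM.pos k)
  have hεp : 0 < ε ^ p / 2 := half_pos (Real.rpow_pos_of_pos hε p)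
  set ε₂ := (ε ^ p / 2) ^ p⁻¹ with hε₂
  have hε₂0 : 0 < ε₂ := Real.rpow_pos_of_pos hεp _
  have hε₂p : ε₂ ^ p = ε ^ p / 2 := by
    rw [hε₂, ← Real.rpow_mul hεp.le, inv_mul_cancel₀ hp0.ne', Real.rpow_one]
  obtain ⟨N, hN⟩ := eventually_atTop.1 (hf.eventually_lt_const (ENNReal.ofReal_pos.2 hε₂0))
  obtain ⟨g, hg, hgk⟩ := hM.exists_approx_finite hp0 hp1 N
    (f := fun n => ⇑(f n).toLp) (fun n => Lp.memLp (f n).toLp) hεp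
  have happrox : ∀ k, eLpNorm (iteratedDeriv k g - ⇑(f k).toLp) (ENNReal.ofReal p) volume ≤
      ENNReal.ofReal ε * ENNReal.ofReal (M k) := by
    intro k
    have hMk := hM.pos k
    have hMp : 0 < M k ^ p := Real.rpow_pos_of_pos hMk p
    rw [← ENNReal.ofReal_mul hε.le, eLpNorm_le_ofReal_iff hp0 _ (mul_pos hε hMk).le,
      Real.mul_rpow hε.le hMk.le]
    have h1 := hgk k
    by_cases hk : k < N
    · simp only [hk, if_true] at h1
      refine h1.trans (ENNReal.ofReal_le_ofReal ?_)
      nlinarith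
    · simp only [hk, if_false, sub_zero] at h1
      have h2 := (hN k (not_lt.1 hk)).le
      rw [ENNReal.div_le_iff (hMpos k).ne' ENNReal.ofReal_ne_top, ← ENNReal.ofReal_mul hε₂0.le,
        LpSpace.qnorm, eLpNorm_le_ofReal_iff hp0 _ (mul_pos hε₂0 hMk).le,
        Real.mul_rpow hε₂0.le hMk.le, hε₂p] at h2
      refine (powIntegral_sub_le hp0.le hp1.le
        (continuous_iteratedDeriv_of_smooth hg.1 k).aestronglyMeasurable _).trans
        ((add_le_add h1 h2).trans_eq ?_)
      rw [← ENNReal.ofReal_add (by positivity) (by positivity)]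
      congr 1
      ring
  refine ⟨⟨g, hg.1, ?_, hg.limsup_le hp0 hp1 hθ⟩, happrox⟩
  have hsup := iSup_lt_top_of_tendsto_zero
    (fun n => ENNReal.div_lt_top (f n).qnorm_lt_top.ne (hMpos n).ne') hf
  set S := ⨆ n, (f n).qnorm / ENNReal.ofReal (M n) with hS
  refine lt_of_le_of_lt (iSup_le fun k => ?_)
    (b := ENNReal.LpAddConst (ENNReal.ofReal p) * (ENNReal.ofReal ε + S))
    (ENNReal.mul_lt_top (ENNReal.LpAddConst_lt_top _)
      (ENNReal.add_lt_top.2 ⟨ENNReal.ofReal_lt_top, hsup⟩))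
  rw [ENNReal.div_le_iff (hMpos k).ne' ENNReal.ofReal_ne_top]
  refine (eLpNorm_le_of_sub (continuous_iteratedDeriv_of_smooth hg.1 k).aestronglyMeasurable
    (Lp.aestronglyMeasurable (f k).toLp)).trans ?_
  rw [mul_assoc, add_mul]
  refine mul_le_mul_right (add_le_add (happrox k) ?_) _
  rw [← ENNReal.div_le_iff (hMpos k).ne' ENNReal.ofReal_ne_top]
  exact le_iSup (fun n => (f n).qnorm / ENNReal.ofReal (M n)) k

theorem CarlemanTest.qnorm_derivLp_sub (f g : CarlemanTest 𝕜 p θ M) (n : ℕ) :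
    (derivLp n f - derivLp n g).qnorm =
      eLpNorm (iteratedDeriv n f.1 - iteratedDeriv n g.1) (ENNReal.ofReal p) volume := by
  rw [LpSpace.qnorm_sub]
  exact eLpNorm_congr_ae
    ((LpSpace.coeFn_ofMemLp (f.memLp n)).sub (LpSpace.coeFn_ofMemLp (g.memLp n)))

theorem eLpNorm_iteratedDeriv_le_carlemanQNorm (hMpos : ∀ n, 0 < M n) (f : ℝ → 𝕜) (n : ℕ) :
    eLpNorm (iteratedDeriv n f) (ENNReal.ofReal p) volume ≤
      carlemanQNorm p M f * ENNReal.ofReal (M n) := by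
  rw [← ENNReal.div_le_iff (ENNReal.ofReal_pos.2 (hMpos n)).ne' ENNReal.ofReal_ne_top]
  exact le_iSup (fun k => eLpNorm (iteratedDeriv k f) (ENNReal.ofReal p) volume /
    ENNReal.ofReal (M k)) n

/-- Approximants with errors `1/(j+1)`, uniform in the order of differentiation, are Cauchy in the
Carleman quasinorm, and their coordinates converge to those of `f`. -/
theorem IsPRegular.exists_carlemanPi_eq (hM : IsPRegular p M) (hp0 : 0 < p) (hp1 : p < 1)
    (hθ : 0 ≤ θ) {f : ℕ → LpSpace 𝕜 p}
    (hf : Tendsto (fun n => (f n).qnorm / ENNReal.ofReal (M n)) atTop (𝓝 0)) :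
    ∃ F : CarlemanSpace 𝕜 p θ M, ∀ n, carlemanPi F n = f n := by
  have := LpSpace.t0Space (𝕜 := 𝕜) hp0
  set C := ENNReal.LpAddConst (ENNReal.ofReal p) with hC
  choose g hg using fun j : ℕ => hM.exists_test (θ := θ) hp0 hp1 hθ hf
    (Nat.one_div_pos_of_nat (α := ℝ) (n := j))
  have hlim : Tendsto (fun j : ℕ => ENNReal.ofReal (1 / ((j : ℝ) + 1))) atTop (𝓝 0) := by
    have := ENNReal.tendsto_ofReal (tendsto_one_div_add_atTop_nhds_zero_nat (𝕜 := ℝ))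
    rwa [ENNReal.ofReal_zero] at this
  have hcau : CauchySeq g := by
    rw [cauchySeq_iff_tendsto,
      (CarlemanTest.hasBasis_uniformity 𝕜 p θ M).tendsto_right_iff]
    intro ε hε
    have h1 : Tendsto (fun q : ℕ × ℕ => C * (ENNReal.ofReal (1 / ((q.1 : ℝ) + 1)) +
        ENNReal.ofReal (1 / ((q.2 : ℝ) + 1)))) atTop (𝓝 0) := by
      rw [← prod_atTop_atTop_eq]
      have h2 := ENNReal.Tendsto.const_mul (a := C)
        ((hlim.comp tendsto_fst).add (hlim.comp tendsto_snd) :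
          Tendsto _ ((atTop : Filter ℕ) ×ˢ (atTop : Filter ℕ)) _)
        (Or.inr (ENNReal.LpAddConst_lt_top _).ne)
      rwa [add_zero, mul_zero] at h2
    filter_upwards [h1.eventually_lt_const hε] with q hq
    refine lt_of_le_of_lt (iSup_le fun k => ?_) hq
    change eLpNorm (iteratedDeriv k ((g q.1).1 - (g q.2).1)) _ _ / _ ≤ _
    rw [ENNReal.div_le_iff (ENNReal.ofReal_pos.2 (hM.pos k)).ne' ENNReal.ofReal_ne_top,
      CarlemanTest.iteratedDeriv_sub, mul_assoc, add_mul]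
    have hfm := Lp.aestronglyMeasurable (f k).toLp
    have h3 := eLpNorm_add_le' (((g q.1).aestronglyMeasurable k).sub hfm)
      (hfm.sub ((g q.2).aestronglyMeasurable k)) (ENNReal.ofReal p)
    rw [sub_add_sub_cancel] at h3
    refine h3.trans (mul_le_mul_right (add_le_add (hg q.1 k) ?_) _)
    rw [eLpNorm_sub_comm]
    exact hg q.2 k
  obtain ⟨F, hF⟩ := cauchySeq_tendsto_of_complete
    ((UniformSpace.Completion.uniformContinuous_coe (CarlemanTest 𝕜 p θ M)).comp_cauchySeq hcau)
  refine ⟨F, fun n => ?_⟩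
  have h1 : Tendsto (fun j => CarlemanTest.derivLp n (g j)) atTop (𝓝 (carlemanPi F n)) := by
    refine (((continuous_carlemanPi hp0 hp1.le n).tendsto F).comp hF).congr fun j => ?_
    exact carlemanPi_coe hp0 (g j) n
  refine tendsto_nhds_unique h1 ?_
  rw [(nhds_basis_uniformity (LpSpace.hasBasis_uniformity 𝕜 p)).tendsto_right_iff]
  intro ε hε
  have h2 := ENNReal.Tendsto.mul_const (b := ENNReal.ofReal (M n)) hlim
    (Or.inr ENNReal.ofReal_ne_top)
  rw [zero_mul] at h2
  filter_upwards [h2.eventually_lt_const hε] with j hj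
  rw [LpSpace.qnorm_sub]
  refine lt_of_le_of_lt (le_trans (le_of_eq (eLpNorm_congr_ae ?_)) (hg j n)) hj
  exact (LpSpace.coeFn_ofMemLp ((g j).memLp n)).sub (EventuallyEq.refl _ _)

theorem carlemanPi_mem_ellInftyLp (hp0 : 0 < p) (hp1 : p ≤ 1) (hMpos : ∀ n, 0 < M n)
    (F : CarlemanSpace 𝕜 p θ M) : carlemanPi F ∈ ellInftyLp 𝕜 p M := by
  set C := ENNReal.LpAddConst (ENNReal.ofReal p) with hC
  have hCtop : C < ∞ := ENNReal.LpAddConst_lt_top _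
  have htri : ∀ x y : LpSpace 𝕜 p, x.qnorm ≤ C * ((x - y).qnorm + y.qnorm) := fun x y => by
    simpa using (LpSpace.isQuasiDist 𝕜 p).triangle x y 0
  have hne : (comap ((↑) : CarlemanTest 𝕜 p θ M → CarlemanSpace 𝕜 p θ M) (𝓝 F)).NeBot :=
    UniformSpace.Completion.isDenseInducing_coe.comap_nhds_neBot F
  have hcau : Cauchy (comap ((↑) : CarlemanTest 𝕜 p θ M → CarlemanSpace 𝕜 p θ M) (𝓝 F)) :=
    cauchy_nhds.comap (UniformSpace.Completion.isUniformInducing_coe _).comap_uniformity.le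
  -- The test functions near `F` form a Cauchy filter, so some member has diameter at most 1. The
  -- function `g` picked from it serves all `n`.
  obtain ⟨t, ht, htU⟩ := (cauchy_iff.1 hcau).2 _
    ((CarlemanTest.hasBasis_uniformity 𝕜 p θ M).mem_of_mem (zero_lt_one (α := ℝ≥0∞)))
  obtain ⟨g, hgt⟩ := Filter.nonempty_of_mem ht
  refine lt_of_le_of_lt (iSup_le fun n => ?_)
    (b := C * (1 + C * (1 + carlemanQNorm p M g.1)))
    (ENNReal.mul_lt_top hCtop (ENNReal.add_lt_top.2 ⟨ENNReal.one_lt_top, ENNReal.mul_lt_top hCtop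
      (ENNReal.add_lt_top.2 ⟨ENNReal.one_lt_top, g.2.2.1⟩)⟩))
  have hMn := ENNReal.ofReal_pos.2 (hMpos n)
  have hlim : Tendsto (CarlemanTest.derivLp n)
      (comap ((↑) : CarlemanTest 𝕜 p θ M → CarlemanSpace 𝕜 p θ M) (𝓝 F))
      (𝓝 (carlemanPi F n)) :=
    (((continuous_carlemanPi hp0 hp1 n).tendsto F).comp tendsto_comap).congr
      fun f => carlemanPi_coe hp0 f n
  -- `f` may depend on `n`: it is used only to be close to `F` in the `n`-th coordinate, while its
  -- distance to `g` is less than 1 in the full quasinorm.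
  obtain ⟨f, hft, hf⟩ := ((eventually_mem_set.2 ht).and
    ((nhds_basis_uniformity (LpSpace.hasBasis_uniformity 𝕜 p)).tendsto_right_iff.1 hlim _
      hMn)).exists
  have h1 : (carlemanPi F n - CarlemanTest.derivLp n f).qnorm ≤ ENNReal.ofReal (M n) := by
    rw [(LpSpace.isQuasiDist 𝕜 p).symm]
    exact (show (CarlemanTest.derivLp n f - carlemanPi F n).qnorm < _ from hf).le
  have h2 : (CarlemanTest.derivLp n f - CarlemanTest.derivLp n g).qnorm ≤
      1 * ENNReal.ofReal (M n) := by
    rw [CarlemanTest.qnorm_derivLp_sub, ← CarlemanTest.iteratedDeriv_sub]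
    refine (eLpNorm_iteratedDeriv_le_carlemanQNorm hMpos _ n).trans (mul_le_mul_left ?_ _)
    have hfg := htU (mk_mem_prod hft hgt)
    rw [mem_ofPred_eq] at hfg
    exact hfg.le
  have h3 : (CarlemanTest.derivLp n g).qnorm ≤ carlemanQNorm p M g.1 * ENNReal.ofReal (M n) :=
    (eLpNorm_congr_ae (LpSpace.coeFn_ofMemLp (g.memLp n))).trans_le
      (eLpNorm_iteratedDeriv_le_carlemanQNorm hMpos _ n)
  rw [ENNReal.div_le_iff hMn.ne' ENNReal.ofReal_ne_top]
  calc (carlemanPi F n).qnorm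
      ≤ C * (ENNReal.ofReal (M n) + C * (1 * ENNReal.ofReal (M n) +
          carlemanQNorm p M g.1 * ENNReal.ofReal (M n))) :=
        (htri _ (CarlemanTest.derivLp n f)).trans (mul_le_mul_right (add_le_add h1
          ((htri _ (CarlemanTest.derivLp n g)).trans (mul_le_mul_right (add_le_add h2 h3) _))) _)
    _ = _ := by ring

end Image

end

theorem mainTheorem5 (𝕜 : Type*) [RCLike 𝕜] (p θ : ℝ) (hp0 : 0 < p) (hp1 : p < 1) (hθ : 0 ≤ θ)
    (M : ℕ → ℝ) (hM : IsPRegular p M) :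
    cZeroLp 𝕜 p M ⊆ Set.range (carlemanPi : CarlemanSpace 𝕜 p θ M → ℕ → LpSpace 𝕜 p) ∧
    Set.range (carlemanPi : CarlemanSpace 𝕜 p θ M → ℕ → LpSpace 𝕜 p) ⊆ ellInftyLp 𝕜 p M ∧
    ∀ f : ℕ → LpSpace 𝕜 p,
      Tendsto (fun n => (f n).qnorm / ENNReal.ofReal (M n)) atTop (𝓝 0) →
        ∃ F : CarlemanSpace 𝕜 p θ M, ∀ n, carlemanPi F n = f n := by
  refine ⟨fun f hf => ?_, ?_, fun f hf => hM.exists_carlemanPi_eq hp0 hp1 hθ hf⟩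
  · obtain ⟨F, hF⟩ := hM.exists_carlemanPi_eq (θ := θ) hp0 hp1 hθ hf.2
    exact ⟨F, funext hF⟩
  · rintro _ ⟨F, rfl⟩
    exact carlemanPi_mem_ellInftyLp hp0 hp1.le hM.pos F
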